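/- **The repair timer.** Let $G$ be a finite connected undirected graph of diameter $\mathcal D$ whose vertices are processes; $\mathcal N_p$ is the set of neighbours of $p$, and $\mathcal T$ is a natural number. Process $p$ has variables $\mathsf{clock}_p$, $\mathsf w_p$ and, for each $q\in\mathcal N_p$, image variables $\mathsf x_p[q],\mathsf y_p[q],\mathsf r_p[q],\mathsf s_p[q]$, and it writes a four-field register $\mathsf{Register}_{pq}$ that only $q$ reads. Variables $\mathsf{clock},\mathsf x,\mathsf r$ and register fields 1 and 3 range over $\{0,\dots,\mathcal T\}$; $\mathsf w,\mathsf y,\mathsf s$ and register fields 2 and 4 range over $\{0,\dots,3\mathcal D+1\}$. For process $p$ put - $\mathit{gap}$: $|\mathsf{clock}-\mathsf x[q]|>1$ for some $q\in\mathcal N_p$; - $\mathit{cEcho}$: $\mathsf{clock}=\mathsf r[q]$ for all $q\in\mathcal N_p$; $\mathit{wEcho}$: $\mathsf w=\mathsf s[q]$ for all $q\in\mathcal N_p$; - $\mathit{cMin}=\min_{q\in\mathcal N_p}\mathsf x[q]$, $\mathit{wMin}=\min_{q\in\mathcal N_p}\mathsf y[q]$ (with $\min\emptyset=\infty$); - $\mathit{wBig}$: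 $\mathsf w\ge 3\mathcal D+1$ or $\mathsf w\ge\mathsf{clock}$; $\mathit{wBigr}$: $\mathsf w\ge 3\mathcal D+1$ or $\mathsf w>\mathsf{clock}$. Each process repeats the following cycle forever. - S1: for each $q\in\mathcal N_p$, read $\mathsf{Register}_{qp}$ into $\langle\mathsf x[q],\mathsf y[q],\mathsf r[q],\mathsf s[q]\rangle$. - S2: if $\mathit{wEcho}$ or $\mathit{wMin}<\mathsf w$, then $\mathsf w\leftarrow 1+\min(\mathsf w,\mathit{wMin},3\mathcal D)$. - S3–S6: a single multiway if statement (if no guard holds, nothing is assigned). - S3: if $\mathit{cEcho}\wedge\mathsf{clock}<\mathcal T\wedge\neg\mathit{gap}\wedge\mathit{wBigr}\wedge\mathsf{clock}\le\mathit{cMin}$, then $\mathsf{clock}\leftarrow\mathsf{clock}+1$. - S4: if $\mathsf{clock}>\mathcal T-\mathcal D\wedge\mathit{gap}$, then $\mathsf{clock},\mathsf w\leftarrow 0,0$. - S5: if $\mathsf{clock}\le\mathcal T-\mathcal D\wedge\mathit{gap}\wedge\neg\mathit{wBig}$, then $\mathsf{clock}\leftarrow\mathsf w$. - S6: if $\mathit{cEcho}\wedge\mathsf{clock}\le\mathcal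 T-\mathcal D\wedge\mathit{gap}\wedge\mathit{wBigr}\wedge\mathsf{clock}\le\mathit{cMin}$, then $\mathsf{clock}\leftarrow\mathsf{clock}+1$. - S7: for each $q\in\mathcal N_p$, write $\mathsf{Register}_{pq}\leftarrow\langle\mathsf{clock},\mathsf w,\mathsf x[q],\mathsf y[q]\rangle$. A process step is one register read, one register write, one execution of S2, or one execution of the multiway if; reads and writes may occur in any order within S1 and S7. A *computation* is an infinite sequence of states in which consecutive states differ by one process step and every process takes infinitely many steps; the initial state (variables, registers and program counters) is arbitrary. The first round of a computation is its shortest initial segment in which every process performs a complete cycle (from its first read to its last write); each later round is the shortest such segment starting at the end of the previous round. A state is *timer-final* (satisfies $\mathcal L_T$) if $\mathsf{clock}_p=\mathcal T$ and $\mathsf w_p=3\mathcal D+1$ for every $p$ and every image variable and register field equals the variable from which it is copied. **Theorem 1.** Assume $\mathcal T\ge 11\mathcal D$. Then: 1. $\mathcal L_T$ is invariant: every process step from a timer-final state leads to a timer-final state. 2. There is an absolute constant $K$ such that every computation, for every such $G$ and $\mathcal T$, contains a timer-final state within its first $K(\mathcal T+1)$ rounds. 3. Consequently, for $\mathcal T=O(\mathcal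 D)$ the timer stabilizes within $O(\mathcal D)$ rounds: for every constant $c$ there is a constant $K$, depending only on $c$, such that if $G$ has at least two vertices and $11\mathcal D\le\mathcal T\le c\,\mathcal D$, then every computation contains a timer-final state within its first $K\mathcal D$ rounds. -/

import Mathlib

namespace RepairTimer

/-- The contents of one link register `Register_{pq}`: the writer's `clock` and `w`, followed by the
writer's images `x[q]`, `y[q]` of the reader's `clock` and `w`. -/
@[ext] structure Reg where
  clock : ℕ
  w : ℕ
  x : ℕ
  y : ℕ

/-- Program counter of a process. `read R`: inside `S1`, the registers of the neighbours in `R` are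
still to be read. `s2`: about to execute `S2`. `s36`: about to execute the multiway `if` made of
`S3`, ..., `S6`. `write R`: inside `S7`, the registers for the neighbours in `R` are still to be
written. -/
inductive PC (V : Type*) where
  | read (R : Set V)
  | s2
  | s36
  | write (R : Set V)

/-- A configuration of one process: its variables, its program counter, and the registers that it
writes. Arrays and registers are indexed by all processes, but only the entries of neighbours are
ever used. -/
structure Config (V : Type*) where
  clock : ℕ
  w : ℕ
  x : V → ℕ
  y : V → ℕ
  r : V → ℕ
  s : V → ℕ
  reg : V → Reg
  pc : PC V

/-- A system state: one configuration for each process. `(σ p).reg q` is `Register_{pq}`. -/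
abbrev State (V : Type*) := V → Config V

section Program

variable {V : Type*} (G : SimpleGraph V) (T : ℕ)

def gap (p : V) (c : Config V) : Prop :=
  ∃ q, G.Adj p q ∧ 1 < |(c.clock : ℤ) - (c.x q : ℤ)|

def cEcho (p : V) (c : Config V) : Prop := ∀ q, G.Adj p q → c.clock = c.r q

def wEcho (p : V) (c : Config V) : Prop := ∀ q, G.Adj p q → c.w = c.s q

/-- The minimum of `y[q]` over the neighbours (`⊤` if there is no neighbour). -/
noncomputable def wMin (p : V) (c : Config V) : ℕ∞ := ⨅ q, ⨅ _ : G.Adj p q, (c.y q : ℕ∞)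

/-- The minimum of `x[q]` over the neighbours (`⊤` if there is no neighbour). -/
noncomputable def cMin (p : V) (c : Config V) : ℕ∞ := ⨅ q, ⨅ _ : G.Adj p q, (c.x q : ℕ∞)

def wBig (c : Config V) : Prop := 3 * G.diam + 1 ≤ c.w ∨ c.clock ≤ c.w

def wBigr (c : Config V) : Prop := 3 * G.diam + 1 ≤ c.w ∨ c.clock < c.w

/-- The assignment of `S2`; the minimum is finite because of the term `w`. -/
noncomputable def execS2 (p : V) (c : Config V) : Config V :=
  open Classical in
  if wEcho G p c ∨ wMin G p c < (c.w : ℕ∞) then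
    { c with w := 1 + (min (c.w : ℕ∞) (min (wMin G p c) ((3 * G.diam : ℕ) : ℕ∞))).toNat }
  else c

/-- The multiway `if` made of `S3`, ..., `S6` (the four guards exclude each other when
`G.diam ≤ T`). -/
noncomputable def execS36 (p : V) (c : Config V) : Config V :=
  open Classical in
  if cEcho G p c ∧ c.clock < T ∧ ¬ gap G p c ∧ wBigr G c ∧ (c.clock : ℕ∞) ≤ cMin G p c then
    { c with clock := c.clock + 1 }
  else if T < c.clock + G.diam ∧ gap G p c then
    { c with clock := 0, w := 0 }
  else if c.clock + G.diam ≤ T ∧ gap G p c ∧ ¬ wBig G c then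
    { c with clock := c.w }
  else if cEcho G p c ∧ c.clock + G.diam ≤ T ∧ gap G p c ∧ wBigr G c ∧
      (c.clock : ℕ∞) ≤ cMin G p c then
    { c with clock := c.clock + 1 }
  else c

/-- Program counter inside `S1` when the registers of `R` remain to be read. -/
noncomputable def readPC (R : Set V) : PC V :=
  open Classical in if R = ∅ then PC.s2 else PC.read R

/-- Program counter at the start of a cycle of `p`. -/
noncomputable def startPC (p : V) : PC V := readPC (G.neighborSet p)

/-- Program counter inside `S7` when the registers of `R` remain to be written; when nothing
remains, the next cycle begins. -/
noncomputable def writePC (p : V) (R : Set V) : PC V :=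
  open Classical in if R = ∅ then startPC G p else PC.write R

/-- The configuration `c` after reading `Register_{qp}` with contents `m`, when `R` was still to be
read. -/
noncomputable def doRead (c : Config V) (q : V) (m : Reg) (R : Set V) : Config V :=
  open Classical in
  { c with
    x := Function.update c.x q m.clock
    y := Function.update c.y q m.w
    r := Function.update c.r q m.x
    s := Function.update c.s q m.y
    pc := readPC (R \ {q}) }

/-- The configuration `c` of `p` after writing `Register_{pq}`, when `R` was still to be written. -/
noncomputable def doWrite (p : V) (c : Config V) (q : V) (R : Set V) : Config V :=
  open Classical in
  { c with
    reg := Function.update c.reg q ⟨c.clock, c.w, c.x q, c.y q⟩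
    pc := writePC G p (R \ {q}) }

/-- `ProcStep G T σ p c`: in state `σ`, one step of process `p` can change its configuration to `c`.
The order of the reads in `S1` and of the writes in `S7` is arbitrary. -/
inductive ProcStep (σ : State V) (p : V) : Config V → Prop
  | read (R : Set V) (q : V) (hpc : (σ p).pc = PC.read R) (hq : q ∈ R) :
      ProcStep σ p (doRead (σ p) q ((σ q).reg p) R)
  | s2 (hpc : (σ p).pc = PC.s2) :
      ProcStep σ p { execS2 G p (σ p) with pc := PC.s36 }
  | s36 (hpc : (σ p).pc = PC.s36) :
      ProcStep σ p { execS36 G T p (σ p) with pc := writePC G p (G.neighborSet p) }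
  | write (R : Set V) (q : V) (hpc : (σ p).pc = PC.write R) (hq : q ∈ R) :
      ProcStep σ p (doWrite G p (σ p) q R)

/-- `Step G T p σ σ'`: `σ'` results from `σ` by one step of process `p`. -/
def Step (p : V) (σ σ' : State V) : Prop :=
  ProcStep G T σ p (σ' p) ∧ ∀ q, q ≠ p → σ' q = σ q

/-- The contents of a register lie in the domains of the variables. -/
def Reg.InDomain (m : Reg) : Prop :=
  m.clock ≤ T ∧ m.w ≤ 3 * G.diam + 1 ∧ m.x ≤ T ∧ m.y ≤ 3 * G.diam + 1

/-- The set of reads or writes that remain is a nonempty set of neighbours. -/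
def PC.InDomain (p : V) : PC V → Prop
  | PC.read R => R.Nonempty ∧ R ⊆ G.neighborSet p
  | PC.s2 => True
  | PC.s36 => True
  | PC.write R => R.Nonempty ∧ R ⊆ G.neighborSet p

/-- Every variable and register field has a value in its (finite) domain: `{0, ..., T}` for `clock`
and its images, `{0, ..., 3D+1}` for `w` and its images. Otherwise the state is arbitrary. -/
def InDomain (σ : State V) : Prop :=
  ∀ p, (σ p).clock ≤ T ∧ (σ p).w ≤ 3 * G.diam + 1 ∧ PC.InDomain G p (σ p).pc ∧
    ∀ q, G.Adj p q →
      (σ p).x q ≤ T ∧ (σ p).y q ≤ 3 * G.diam + 1 ∧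
      (σ p).r q ≤ T ∧ (σ p).s q ≤ 3 * G.diam + 1 ∧ Reg.InDomain G T ((σ p).reg q)

/-- A computation from an arbitrary initial state: an infinite sequence of process steps in which
every process takes infinitely many steps. -/
structure IsComputation (σ : ℕ → State V) : Prop where
  init : InDomain G T (σ 0)
  step : ∀ i, ∃ p, Step G T p (σ i) (σ (i + 1))
  fair : ∀ p i, ∃ j, i ≤ j ∧ Step G T p (σ j) (σ (j + 1))

/-- Between the states number `a` and `b`, process `p` completes a cycle, from its first read to
its last write: `p` is at the start of a cycle, leaves it, and is at the start of a cycle again. -/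
def CompletesCycle (σ : ℕ → State V) (p : V) (a b : ℕ) : Prop :=
  ∃ i m j, a ≤ i ∧ i < m ∧ m < j ∧ j ≤ b ∧
    (σ i p).pc = startPC G p ∧ (σ m p).pc ≠ startPC G p ∧ (σ j p).pc = startPC G p

/-- The index of the state at the end of round `k` (and `0` for `k = 0`): round `k + 1` starts at
the last state of round `k` and is the shortest segment in which every process completes a cycle. -/
noncomputable def roundEnd (σ : ℕ → State V) : ℕ → ℕ
  | 0 => 0
  | k + 1 => sInf {b | ∀ p, CompletesCycle G σ p (roundEnd σ k) b}

/-- The predicate `L_T`: every `clock` is `T`, every `w` is `3D+1`, and every image variable and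
register field equals the variable on which it is based. -/
def TimerFinal (σ : State V) : Prop :=
  (∀ p, (σ p).clock = T ∧ (σ p).w = 3 * G.diam + 1) ∧
  ∀ p q, G.Adj p q →
    (σ p).reg q = ⟨(σ p).clock, (σ p).w, (σ p).x q, (σ p).y q⟩ ∧
    (σ p).x q = (σ q).clock ∧ (σ p).y q = (σ q).w ∧
    (σ p).r q = (σ q).x p ∧ (σ p).s q = (σ q).y p

/-- `L_T` is preserved by every process step. -/
def FinalInvariant : Prop :=
  ∀ (p : V) (σ σ' : State V), TimerFinal G T σ → Step G T p σ σ' → TimerFinal G T σ'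

/-- Every computation contains a timer-final state within its first `k` rounds. -/
def FinalWithin (k : ℕ) : Prop :=
  ∀ σ : ℕ → State V, IsComputation G T σ → ∃ t, t ≤ roundEnd G σ k ∧ TimerFinal G T (σ t)

end Program

end RepairTimer

/-! Write `D` for the diameter. A timer-final state is a fixed point of every assignment, which
gives invariance. Convergence compares a process's clock with its `w`, which can rise only after all
neighbours have echoed it.

Grounding (`IsComputation.allLevel`): after `7m` rounds every pair of a clock and a `w`, in
variables, registers and images, satisfies `clock ≤ w` or `m ≤ w`, apart from a transient exception
between `S2` and the multiway `if`. For `m = 3D + 1` this says that a small `w` certifies a small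
clock.

Progress (`IsComputation.timerFinal_of_noReset`): while no reset occurs, the minimum of all `w` and
their copies grows by one every seven rounds up to `3D + 1`; then the minimum of all clocks grows
likewise up to `T`. So it suffices to find a long stretch without resets.

Low clocks (`IsComputation.not_resetAt_of_low`): once all clocks and their copies are at most `B`,
with `B + 4D + 1 ≤ T`, no reset ever happens again, because clocks that climb far above `B` stay
within one of their neighbours.

A reset makes clocks low. It sets `w` to `0` at some `p`. If `w` at `p` remains at most `2D` for
long enough, every `w` falls to at most `3D`, and grounding bounds every clock
(`IsComputation.clocksLow_of_w_le`). If it passes `2D`, then the echoes force a wave of raises to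
have crossed the whole graph, and the wave leaves all clocks at most `4D`
(`IsComputation.clocksLow_of_wave`). The delicate point is `IsComputation.w_le_add_two`: stale link
contents can falsify an echo by at most two raises. -/

namespace RepairTimer

/-! ### The assignments of one process as arithmetic -/

section Local

variable {V : Type*} {G : SimpleGraph V} {T : ℕ} {p : V} {c : Config V}

/-- The images that `c` holds of the variables of `q`, arranged as the register they are read
from. -/
def Config.image (c : Config V) (q : V) : Reg := ⟨c.x q, c.y q, c.r q, c.s q⟩

/-- The contents that `c` writes into its register for `q`. -/
def Config.output (c : Config V) (q : V) : Reg := ⟨c.clock, c.w, c.x q, c.y q⟩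

theorem le_wMin_iff {n : ℕ} : (n : ℕ∞) ≤ wMin G p c ↔ ∀ q, G.Adj p q → n ≤ c.y q := by
  simp [wMin]

theorem le_cMin_iff {n : ℕ} : (n : ℕ∞) ≤ cMin G p c ↔ ∀ q, G.Adj p q → n ≤ c.x q := by
  simp [cMin]

theorem exists_eq_wMin {n : ℕ} (h : wMin G p c < (n : ℕ∞)) :
    ∃ q, G.Adj p q ∧ c.y q < n ∧ (∀ q', G.Adj p q' → c.y q ≤ c.y q') ∧
      wMin G p c = (c.y q : ℕ∞) := by
  have hne : ∃ m, ∃ q, G.Adj p q ∧ c.y q = m := by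
    by_contra! hcon
    apply absurd h
    rw [not_lt, le_wMin_iff]
    intro q hq
    exact absurd rfl (hcon _ q hq)
  classical
  obtain ⟨q, hq, hqm⟩ := Nat.find_spec hne
  have hmin : ∀ q', G.Adj p q' → c.y q ≤ c.y q' := fun q' hq' => by
    rw [hqm]
    exact Nat.find_min' hne ⟨q', hq', rfl⟩
  have heq : wMin G p c = (c.y q : ℕ∞) :=
    le_antisymm (iInf₂_le q hq) (le_wMin_iff.2 hmin)
  refine ⟨q, hq, ?_, hmin, heq⟩
  rw [heq] at h
  exact_mod_cast h

/-- The three behaviours are: keep, raise after an echo, and follow a minimal neighbour. The last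
never increases `w`, since `y q < w`. -/
theorem execS2_w_cases (G : SimpleGraph V) (p : V) (c : Config V) :
    ((execS2 G p c).w = c.w ∧ ¬ wEcho G p c ∧ ∀ q, G.Adj p q → c.w ≤ c.y q) ∨
    ((execS2 G p c).w = 1 + min c.w (3 * G.diam) ∧ wEcho G p c ∧
      ∀ q, G.Adj p q → c.w ≤ c.y q) ∨
    ∃ q, G.Adj p q ∧ c.y q < c.w ∧ (∀ q', G.Adj p q' → c.y q ≤ c.y q') ∧
      (execS2 G p c).w = 1 + min (c.y q) (3 * G.diam) := by
  by_cases hlt : wMin G p c < (c.w : ℕ∞)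
  · obtain ⟨q, hq, hqw, hmin, heq⟩ := exists_eq_wMin hlt
    refine Or.inr (Or.inr ⟨q, hq, hqw, hmin, ?_⟩)
    rw [execS2, if_pos (Or.inr hlt)]
    simp only [heq]
    have : min (c.w : ℕ∞) (min (c.y q : ℕ∞) ((3 * G.diam : ℕ) : ℕ∞)) =
        ((min (c.y q) (3 * G.diam) : ℕ) : ℕ∞) := by
      rw [← Nat.mono_cast.map_min, ← Nat.mono_cast.map_min]
      congr 1
      omega
    simp only [this, ENat.toNat_natCast]
  · have hle := le_wMin_iff.1 (not_lt.1 hlt)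
    by_cases he : wEcho G p c
    · refine Or.inr (Or.inl ⟨?_, he, hle⟩)
      rw [execS2, if_pos (Or.inl he)]
      have : min (c.w : ℕ∞) (min (wMin G p c) ((3 * G.diam : ℕ) : ℕ∞)) =
          ((min c.w (3 * G.diam) : ℕ) : ℕ∞) := by
        rw [← min_assoc, min_eq_left (not_lt.1 hlt), ← Nat.mono_cast.map_min]
      simp only [this, ENat.toNat_natCast]
    · refine Or.inl ⟨?_, he, hle⟩
      simp [execS2, he, hlt]

theorem execS2_eq (G : SimpleGraph V) (p : V) (c : Config V) :
    execS2 G p c = { c with w := (execS2 G p c).w } := by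
  unfold execS2
  split_ifs <;> rfl

/-- `S3` and `S6` share the first case, as both increment the clock. The last case keeps just what
later arguments need from the failure of all guards. -/
theorem execS36_cases (G : SimpleGraph V) (T : ℕ) (p : V) (c : Config V) :
    (execS36 G T p c = { c with clock := c.clock + 1 } ∧ cEcho G p c ∧ wBigr G c ∧
      (∀ q, G.Adj p q → c.clock ≤ c.x q) ∧
      (c.clock < T ∧ ¬ gap G p c ∨ gap G p c ∧ c.clock + G.diam ≤ T)) ∨
    (execS36 G T p c = { c with clock := 0, w := 0 } ∧ T < c.clock + G.diam ∧ gap G p c) ∨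
    (execS36 G T p c = { c with clock := c.w } ∧ c.clock + G.diam ≤ T ∧ gap G p c ∧
      ¬ wBig G c) ∨
    (execS36 G T p c = c ∧ (gap G p c → c.clock + G.diam ≤ T ∧ wBig G c) ∧
      (cEcho G p c → wBigr G c → (∀ q, G.Adj p q → c.clock ≤ c.x q) →
        ¬ gap G p c ∧ T ≤ c.clock)) := by
  unfold execS36
  split_ifs with h1 h2 h3 h4
  · exact Or.inl ⟨rfl, h1.1, h1.2.2.2.1, le_cMin_iff.1 h1.2.2.2.2, Or.inl ⟨h1.2.1, h1.2.2.1⟩⟩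
  · exact Or.inr (Or.inl ⟨rfl, h2⟩)
  · exact Or.inr (Or.inr (Or.inl ⟨rfl, h3⟩))
  · exact Or.inl ⟨rfl, h4.1, h4.2.2.2.1, le_cMin_iff.1 h4.2.2.2.2, Or.inr ⟨h4.2.2.1, h4.2.1⟩⟩
  · refine Or.inr (Or.inr (Or.inr ⟨rfl, fun hg => ?_, fun he hw hc => ?_⟩))
    · have hle : c.clock + G.diam ≤ T := by
        by_contra hcon
        exact h2 ⟨not_le.1 hcon, hg⟩
      refine ⟨hle, ?_⟩
      by_contra hb
      exact h3 ⟨hle, hg, hb⟩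
    · have hng : ¬ gap G p c := fun hg => by
        by_cases hle : c.clock + G.diam ≤ T
        · exact h4 ⟨he, hle, hg, hw, le_cMin_iff.2 hc⟩
        · exact h2 ⟨not_le.1 hle, hg⟩
      refine ⟨hng, ?_⟩
      by_contra hcon
      exact h1 ⟨he, not_le.1 hcon, hng, hw, le_cMin_iff.2 hc⟩

theorem not_gap_le (h : ¬ gap G p c) {q : V} (hq : G.Adj p q) :
    c.clock ≤ c.x q + 1 ∧ c.x q ≤ c.clock + 1 := by
  have : ¬ 1 < |(c.clock : ℤ) - (c.x q : ℤ)| := fun hcon => h ⟨q, hq, hcon⟩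
  rw [not_lt, abs_le] at this
  omega

theorem not_gap_of_forall
    (h : ∀ q, G.Adj p q → c.clock ≤ c.x q + 1 ∧ c.x q ≤ c.clock + 1) : ¬ gap G p c := by
  rintro ⟨q, hq, hlt⟩
  have := h q hq
  rw [lt_abs] at hlt
  omega

end Local

/-! ### Process steps as events at indices of a computation -/

section Events

variable {V : Type*} (G : SimpleGraph V) (T : ℕ) (σ : ℕ → State V)

/-- At index `i`, process `p` reads the register of `q`. -/
def ReadAt (p q : V) (i : ℕ) : Prop :=
  ∃ R, (σ i p).pc = PC.read R ∧ q ∈ R ∧ σ (i + 1) p = doRead (σ i p) q ((σ i q).reg p) R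

/-- At index `i`, process `p` writes its register for `q`. -/
def WriteAt (p q : V) (i : ℕ) : Prop :=
  ∃ R, (σ i p).pc = PC.write R ∧ q ∈ R ∧ σ (i + 1) p = doWrite G p (σ i p) q R

/-- At index `i`, process `p` executes `S2`. -/
def S2At (p : V) (i : ℕ) : Prop :=
  (σ i p).pc = PC.s2 ∧ σ (i + 1) p = { execS2 G p (σ i p) with pc := PC.s36 }

/-- At index `i`, process `p` executes the multiway `if`. -/
def S36At (p : V) (i : ℕ) : Prop :=
  (σ i p).pc = PC.s36 ∧
    σ (i + 1) p = { execS36 G T p (σ i p) with pc := writePC G p (G.neighborSet p) }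

/-- At index `i`, process `p` executes the assignment of `S4`. -/
def ResetAt (p : V) (i : ℕ) : Prop :=
  S36At G T σ p i ∧ T < (σ i p).clock + G.diam ∧ gap G p (σ i p)

variable {G T σ}

theorem IsComputation.event (h : IsComputation G T σ) (p : V) (i : ℕ) :
    σ (i + 1) p = σ i p ∨ (∃ q, ReadAt σ p q i) ∨ S2At G σ p i ∨ S36At G T σ p i ∨
      ∃ q, WriteAt G σ p q i := by
  obtain ⟨p', hstep, hother⟩ := h.step i
  by_cases hp : p = p'
  · subst hp
    right
    generalize hc : σ (i + 1) p = c at hstep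
    cases hstep with
    | read R q hpc hq => exact Or.inl ⟨q, R, hpc, hq, hc⟩
    | s2 hpc => exact Or.inr (Or.inl ⟨hpc, hc⟩)
    | s36 hpc => exact Or.inr (Or.inr (Or.inl ⟨hpc, hc⟩))
    | write R q hpc hq => exact Or.inr (Or.inr (Or.inr ⟨q, R, hpc, hq, hc⟩))
  · exact Or.inl (hother p hp)

theorem IsComputation.exists_event (h : IsComputation G T σ) (p : V) (i : ℕ) :
    ∃ j, i ≤ j ∧ ((∃ q, ReadAt σ p q j) ∨ S2At G σ p j ∨ S36At G T σ p j ∨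
      ∃ q, WriteAt G σ p q j) := by
  obtain ⟨j, hj, hstep, -⟩ := h.fair p i
  refine ⟨j, hj, ?_⟩
  generalize hc : σ (j + 1) p = c at hstep
  cases hstep with
  | read R q hpc hq => exact Or.inl ⟨q, R, hpc, hq, hc⟩
  | s2 hpc => exact Or.inr (Or.inl ⟨hpc, hc⟩)
  | s36 hpc => exact Or.inr (Or.inr (Or.inl ⟨hpc, hc⟩))
  | write R q hpc hq => exact Or.inr (Or.inr (Or.inr ⟨q, R, hpc, hq, hc⟩))

theorem ReadAt.next {p q : V} {i : ℕ} (h : ReadAt σ p q i) :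
    (σ (i + 1) p).clock = (σ i p).clock ∧ (σ (i + 1) p).w = (σ i p).w ∧
      (σ (i + 1) p).reg = (σ i p).reg ∧ (σ (i + 1) p).image q = (σ i q).reg p ∧
      ∀ q', q' ≠ q → (σ (i + 1) p).image q' = (σ i p).image q' := by
  obtain ⟨R, -, -, hn⟩ := h
  rw [hn]
  refine ⟨rfl, rfl, rfl, ?_, fun q' hq' => ?_⟩
  · simp [doRead, Config.image]
  · simp [doRead, Config.image, hq']

theorem WriteAt.next {p q : V} {i : ℕ} (h : WriteAt G σ p q i) :
    (σ (i + 1) p).clock = (σ i p).clock ∧ (σ (i + 1) p).w = (σ i p).w ∧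
      (∀ q', (σ (i + 1) p).image q' = (σ i p).image q') ∧
      (σ (i + 1) p).reg q = (σ i p).output q ∧
      ∀ q', q' ≠ q → (σ (i + 1) p).reg q' = (σ i p).reg q' := by
  obtain ⟨R, -, -, hn⟩ := h
  rw [hn]
  refine ⟨rfl, rfl, fun _ => rfl, ?_, fun q' hq' => ?_⟩
  · simp [doWrite, Config.output]
  · simp [doWrite, hq']

theorem S2At.next {p : V} {i : ℕ} (h : S2At G σ p i) :
    (σ (i + 1) p).clock = (σ i p).clock ∧ (σ (i + 1) p).w = (execS2 G p (σ i p)).w ∧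
      (∀ q', (σ (i + 1) p).image q' = (σ i p).image q') ∧
      (σ (i + 1) p).reg = (σ i p).reg ∧ (σ (i + 1) p).pc = PC.s36 := by
  obtain ⟨-, hn⟩ := h
  rw [hn]
  have := execS2_eq G p (σ i p)
  refine ⟨?_, rfl, fun _ => ?_, ?_, rfl⟩
  · rw [this]
  · rw [this]; rfl
  · rw [this]

theorem S36At.next {p : V} {i : ℕ} (h : S36At G T σ p i) :
    (∀ q', (σ (i + 1) p).image q' = (σ i p).image q') ∧
      (σ (i + 1) p).reg = (σ i p).reg := by
  obtain ⟨-, hn⟩ := h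
  rw [hn]
  rcases execS36_cases G T p (σ i p) with ⟨h, -⟩ | ⟨h, -⟩ | ⟨h, -⟩ | ⟨h, -⟩ <;> rw [h] <;>
    exact ⟨fun _ => rfl, rfl⟩

theorem S36At.cases {p : V} {i : ℕ} (h : S36At G T σ p i) :
    ((σ (i + 1) p).clock = (σ i p).clock + 1 ∧ (σ (i + 1) p).w = (σ i p).w ∧
      cEcho G p (σ i p) ∧ wBigr G (σ i p) ∧
      (∀ q, G.Adj p q → (σ i p).clock ≤ (σ i p).x q) ∧
      ((σ i p).clock < T ∧ ¬ gap G p (σ i p) ∨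
        gap G p (σ i p) ∧ (σ i p).clock + G.diam ≤ T)) ∨
    ((σ (i + 1) p).clock = 0 ∧ (σ (i + 1) p).w = 0 ∧ ResetAt G T σ p i) ∨
    ((σ (i + 1) p).clock = (σ i p).w ∧ (σ (i + 1) p).w = (σ i p).w ∧
      (σ i p).clock + G.diam ≤ T ∧ gap G p (σ i p) ∧
      (σ i p).w < 3 * G.diam + 1 ∧ (σ i p).w < (σ i p).clock) ∨
    ((σ (i + 1) p).clock = (σ i p).clock ∧ (σ (i + 1) p).w = (σ i p).w ∧
      (gap G p (σ i p) → (σ i p).clock + G.diam ≤ T ∧ wBig G (σ i p)) ∧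
      (cEcho G p (σ i p) → wBigr G (σ i p) →
        (∀ q, G.Adj p q → (σ i p).clock ≤ (σ i p).x q) →
        ¬ gap G p (σ i p) ∧ T ≤ (σ i p).clock)) := by
  have h0 := h
  obtain ⟨-, hn⟩ := h
  rw [hn]
  rcases execS36_cases G T p (σ i p) with ⟨h, h'⟩ | ⟨h, h'⟩ | ⟨h, h'⟩ | ⟨h, h'⟩ <;> rw [h]
  · exact Or.inl ⟨rfl, rfl, h'⟩
  · exact Or.inr (Or.inl ⟨rfl, rfl, h0, h'⟩)
  · refine Or.inr (Or.inr (Or.inl ⟨rfl, rfl, h'.1, h'.2.1, ?_⟩))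
    have := h'.2.2
    unfold wBig at this
    omega
  · exact Or.inr (Or.inr (Or.inr ⟨rfl, rfl, h'⟩))

theorem ResetAt.w_next {p : V} {i : ℕ} (h : ResetAt G T σ p i) : (σ (i + 1) p).w = 0 := by
  obtain ⟨hs, h1, h2⟩ := h
  rcases hs.cases with ⟨-, -, -, -, -, ⟨-, h3⟩ | ⟨-, h3⟩⟩ | ⟨-, h3, -⟩ | ⟨-, -, h3, -⟩ |
    ⟨-, -, h3, -⟩
  · exact absurd h2 h3
  · omega
  · exact h3
  · omega
  · have := (h3 h2).1
    omega

end Events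

/-! ### Rounds are finite and contain every kind of event -/

section Rounds

variable {V : Type*} {G : SimpleGraph V} {T : ℕ} {σ : ℕ → State V}

theorem readPC_empty : readPC (∅ : Set V) = PC.s2 := if_pos rfl

theorem readPC_of_ne {R : Set V} (h : R ≠ ∅) : readPC R = PC.read R := if_neg h

theorem writePC_empty (G : SimpleGraph V) (p : V) : writePC G p ∅ = startPC G p := if_pos rfl

theorem writePC_of_ne (G : SimpleGraph V) (p : V) {R : Set V} (h : R ≠ ∅) :
    writePC G p R = PC.write R := if_neg h

theorem readPC_inDomain {p : V} {R : Set V} (h : R ⊆ G.neighborSet p) :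
    PC.InDomain G p (readPC R) := by
  by_cases hR : R = ∅
  · rw [hR, readPC_empty]; trivial
  · rw [readPC_of_ne hR]; exact ⟨Set.nonempty_iff_ne_empty.2 hR, h⟩

theorem writePC_inDomain {p : V} {R : Set V} (h : R ⊆ G.neighborSet p) :
    PC.InDomain G p (writePC G p R) := by
  by_cases hR : R = ∅
  · rw [hR, writePC_empty]; exact readPC_inDomain le_rfl
  · rw [writePC_of_ne G p hR]; exact ⟨Set.nonempty_iff_ne_empty.2 hR, h⟩

theorem ReadAt.pc_next {p q : V} {i : ℕ} {R : Set V} (h : ReadAt σ p q i)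
    (hR : (σ i p).pc = PC.read R) : q ∈ R ∧ (σ (i + 1) p).pc = readPC (R \ {q}) := by
  obtain ⟨R', hpc, hq, hn⟩ := h
  rw [hR] at hpc
  cases hpc
  exact ⟨hq, by rw [hn]; rfl⟩

theorem WriteAt.pc_next {p q : V} {i : ℕ} {R : Set V} (h : WriteAt G σ p q i)
    (hR : (σ i p).pc = PC.write R) : q ∈ R ∧ (σ (i + 1) p).pc = writePC G p (R \ {q}) := by
  obtain ⟨R', hpc, hq, hn⟩ := h
  rw [hR] at hpc
  cases hpc
  exact ⟨hq, by rw [hn]; rfl⟩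

theorem S36At.pc_next {p : V} {i : ℕ} (h : S36At G T σ p i) :
    (σ (i + 1) p).pc = writePC G p (G.neighborSet p) := by
  rw [h.2]

theorem IsComputation.pc_inDomain (h : IsComputation G T σ) (p : V) (i : ℕ) :
    PC.InDomain G p (σ i p).pc := by
  induction i with
  | zero => exact (h.init p).2.2.1
  | succ i ih =>
    rcases h.event p i with he | ⟨q, hr⟩ | hs | hs | ⟨q, hw⟩
    · rw [he]; exact ih
    · obtain ⟨R, hpc, -, -⟩ := id hr
      rw [(hr.pc_next hpc).2]
      rw [hpc] at ih
      exact readPC_inDomain (Set.sdiff_subset.trans ih.2)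
    · rw [hs.next.2.2.2.2]; trivial
    · rw [hs.pc_next]; exact writePC_inDomain le_rfl
    · obtain ⟨R, hpc, -, -⟩ := id hw
      rw [(hw.pc_next hpc).2]
      rw [hpc] at ih
      exact writePC_inDomain (Set.sdiff_subset.trans ih.2)

theorem IsComputation.adj_of_readAt (h : IsComputation G T σ) {p q : V} {i : ℕ}
    (hr : ReadAt σ p q i) : G.Adj p q := by
  obtain ⟨R, hpc, hq, -⟩ := hr
  have := h.pc_inDomain p i
  rw [hpc] at this
  exact this.2 hq

theorem execS2_w_le {p : V} {c : Config V} (h : c.w ≤ 3 * G.diam + 1) :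
    (execS2 G p c).w ≤ 3 * G.diam + 1 := by
  rcases execS2_w_cases G p c with ⟨h1, -⟩ | ⟨h1, -⟩ | ⟨q, -, -, -, h1⟩ <;> omega

theorem IsComputation.w_le (h : IsComputation G T σ) (p : V) (i : ℕ) :
    (σ i p).w ≤ 3 * G.diam + 1 := by
  induction i with
  | zero => exact (h.init p).2.1
  | succ i ih =>
    rcases h.event p i with he | ⟨q, hr⟩ | hs | hs | ⟨q, hw⟩
    · rw [he]; exact ih
    · rw [hr.next.2.1]; exact ih
    · rw [hs.next.2.1]; exact execS2_w_le ih
    · rcases hs.cases with ⟨-, h2, -⟩ | ⟨-, h2, -⟩ | ⟨-, h2, -⟩ | ⟨-, h2, -⟩ <;> omega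
    · rw [hw.next.2.1]; exact ih

/-- `S6` increments under `clock + D ≤ T` only, which keeps the clock in range if `D` is positive;
for `D = 0` the absence of edges rules out a gap. -/
theorem IsComputation.clock_le (h : IsComputation G T σ)
    (hD : G.diam = 0 → ∀ p q, ¬ G.Adj p q) (p : V) (i : ℕ) : (σ i p).clock ≤ T := by
  induction i with
  | zero => exact (h.init p).1
  | succ i ih =>
    rcases h.event p i with he | ⟨q, hr⟩ | hs | hs | ⟨q, hw⟩
    · rw [he]; exact ih
    · rw [hr.next.1]; exact ih
    · rw [hs.next.1]; exact ih
    · rcases hs.cases with ⟨h1, -, -, -, -, ⟨h2, -⟩ | ⟨⟨q, hq, -⟩, h2⟩⟩ | ⟨h1, -⟩ | h1 | ⟨h1, -⟩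
      · omega
      · have : G.diam ≠ 0 := fun h0 => hD h0 p q hq
        omega
      · omega
      · omega
      · omega
    · rw [hw.next.1]; exact ih

/-- The number of steps that a process with program counter `pc` needs to reach the start of a
cycle. -/
noncomputable def stepsLeft (G : SimpleGraph V) (p : V) : PC V → ℕ
  | PC.read R => R.ncard + (G.neighborSet p).ncard + 2
  | PC.s2 => (G.neighborSet p).ncard + 2
  | PC.s36 => (G.neighborSet p).ncard + 1
  | PC.write R => R.ncard

theorem IsComputation.exists_next_event (h : IsComputation G T σ) (p : V) (i : ℕ) :
    ∃ j, i ≤ j ∧ σ j p = σ i p ∧ ((∃ q, ReadAt σ p q j) ∨ S2At G σ p j ∨ S36At G T σ p j ∨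
      ∃ q, WriteAt G σ p q j) := by
  classical
  have hex := h.exists_event p i
  obtain ⟨hle, hev⟩ := Nat.find_spec hex
  refine ⟨Nat.find hex, hle, ?_, hev⟩
  have key : ∀ j, i ≤ j → j ≤ Nat.find hex → σ j p = σ i p := by
    intro j hj
    induction j, hj using Nat.le_induction with
    | base => exact fun _ => rfl
    | succ j hj ih =>
      intro hlt
      rw [← ih (by omega)]
      rcases h.event p j with he | he
      · exact he
      · exact absurd ⟨hj, he⟩ (Nat.find_min hex hlt)
  exact key _ hle le_rfl

theorem IsComputation.exists_start [Finite V] (h : IsComputation G T σ) (p : V) (i : ℕ) :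
    ∃ j, i ≤ j ∧ (σ j p).pc = startPC G p := by
  induction hn : stepsLeft G p (σ i p).pc using Nat.strong_induction_on generalizing i with
  | _ n ih =>
    subst hn
    obtain ⟨j, hij, heq, hev⟩ := h.exists_next_event p i
    suffices hs : (σ (j + 1) p).pc = startPC G p ∨
        stepsLeft G p (σ (j + 1) p).pc < stepsLeft G p (σ i p).pc by
      rcases hs with hs | hs
      · exact ⟨j + 1, by omega, hs⟩
      · obtain ⟨j', hj', hpc⟩ := ih _ hs (j + 1) rfl
        exact ⟨j', by omega, hpc⟩
    rw [← heq]
    rcases hev with ⟨q, hr⟩ | hs | hs | ⟨q, hw⟩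
    · right
      obtain ⟨R, hpc, hq, -⟩ := id hr
      rw [(hr.pc_next hpc).2, hpc]
      have hlt := Set.ncard_sdiff_singleton_lt_of_mem hq (Set.toFinite R)
      by_cases hR : R \ {q} = ∅
      · rw [hR, readPC_empty]; simp only [stepsLeft]; omega
      · rw [readPC_of_ne hR]; simp only [stepsLeft]; omega
    · right
      rw [hs.next.2.2.2.2, hs.1]; simp only [stepsLeft]; omega
    · rw [hs.pc_next, hs.1]
      by_cases hR : G.neighborSet p = ∅
      · left; rw [hR, writePC_empty]
      · right; rw [writePC_of_ne G p hR]; simp only [stepsLeft]; omega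
    · obtain ⟨R, hpc, hq, -⟩ := id hw
      rw [(hw.pc_next hpc).2, hpc]
      have hlt := Set.ncard_sdiff_singleton_lt_of_mem hq (Set.toFinite R)
      by_cases hR : R \ {q} = ∅
      · left; rw [hR, writePC_empty]
      · right; rw [writePC_of_ne G p hR]; simp only [stepsLeft]; omega

theorem IsComputation.exists_leave_start (h : IsComputation G T σ) (p : V) (i : ℕ)
    (hi : (σ i p).pc = startPC G p) : ∃ j, i < j ∧ (σ j p).pc ≠ startPC G p := by
  obtain ⟨j, hij, heq, hev⟩ := h.exists_next_event p i
  refine ⟨j + 1, by omega, ?_⟩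
  have hpc : (σ j p).pc = startPC G p := by rw [heq, hi]
  rcases hev with ⟨q, hr⟩ | hs | hs | ⟨q, hw⟩
  · obtain ⟨R, hpc', hq, -⟩ := id hr
    rw [(hr.pc_next hpc').2, ← hpc, hpc']
    by_cases hR : R \ {q} = ∅
    · rw [hR, readPC_empty]; exact nofun
    · rw [readPC_of_ne hR]
      intro hcon
      have hRR := (PC.read.injEq _ _).mp hcon
      rw [← hRR] at hq
      exact hq.2 rfl
  · rw [hs.next.2.2.2.2, ← hpc, hs.1]; exact nofun
  · exfalso
    rw [hs.1, startPC] at hpc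
    by_cases hR : G.neighborSet p = ∅
    · rw [hR, readPC_empty] at hpc; cases hpc
    · rw [readPC_of_ne hR] at hpc; cases hpc
  · exfalso
    obtain ⟨R, hpc', -, -⟩ := hw
    rw [hpc', startPC] at hpc
    by_cases hR : G.neighborSet p = ∅
    · rw [hR, readPC_empty] at hpc; cases hpc
    · rw [readPC_of_ne hR] at hpc; cases hpc

theorem IsComputation.exists_completesCycle [Finite V] (h : IsComputation G T σ) (p : V)
    (a : ℕ) : ∃ b, CompletesCycle G σ p a b := by
  obtain ⟨i, hai, hi⟩ := h.exists_start p a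
  obtain ⟨m, him, hm⟩ := h.exists_leave_start p i hi
  obtain ⟨j, hmj, hj⟩ := h.exists_start p m
  refine ⟨j, i, m, j, hai, him, ?_, le_rfl, hi, hm, hj⟩
  rcases hmj.lt_or_eq with h1 | h1
  · exact h1
  · subst h1; exact absurd hj hm

theorem IsComputation.completesCycle_roundEnd [Finite V] (h : IsComputation G T σ) (k : ℕ)
    (p : V) : CompletesCycle G σ p (roundEnd G σ k) (roundEnd G σ (k + 1)) := by
  have hne : {b | ∀ p, CompletesCycle G σ p (roundEnd G σ k) b}.Nonempty := by
    choose f hf using fun p => h.exists_completesCycle p (roundEnd G σ k)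
    obtain ⟨M, hM⟩ := (Set.finite_range f).bddAbove
    refine ⟨M, fun p => ?_⟩
    obtain ⟨i, m, j, h1, h2, h3, h4, h5⟩ := hf p
    exact ⟨i, m, j, h1, h2, h3, h4.trans (hM ⟨p, rfl⟩), h5⟩
  exact Nat.sInf_mem hne p

theorem IsComputation.roundEnd_lt [Finite V] [Nonempty V] (h : IsComputation G T σ) (k : ℕ) :
    roundEnd G σ k < roundEnd G σ (k + 1) := by
  obtain ⟨i, m, j, h1, h2, h3, h4, -⟩ := h.completesCycle_roundEnd k (Classical.arbitrary V)
  omega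

theorem IsComputation.roundEnd_strictMono [Finite V] [Nonempty V] (h : IsComputation G T σ) :
    StrictMono (roundEnd G σ) :=
  strictMono_nat_of_lt_succ h.roundEnd_lt

theorem CompletesCycle.events (h : IsComputation G T σ) {p : V} {a b : ℕ}
    (hc : CompletesCycle G σ p a b) :
    (∀ q, G.Adj p q → ∃ i, a ≤ i ∧ i < b ∧ ReadAt σ p q i) ∧
    (∃ i, a ≤ i ∧ i < b ∧ S2At G σ p i) ∧ (∃ i, a ≤ i ∧ i < b ∧ S36At G T σ p i) ∧
    (∀ q, G.Adj p q → ∃ i, a ≤ i ∧ i < b ∧ WriteAt G σ p q i) := by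
  obtain ⟨i, m, j, hai, him, hmj, hjb, hi, hm, hj⟩ := hc
  have mono : ∀ {P : ℕ → Prop} {t t' : ℕ}, t ≤ t' → (∃ n, a ≤ n ∧ n < t ∧ P n) →
      ∃ n, a ≤ n ∧ n < t' ∧ P n := fun htt' ⟨n, h1, h2, h3⟩ => ⟨n, h1, h2.trans_le htt', h3⟩
  let Rs : ℕ → V → Prop := fun t q => ∃ n, a ≤ n ∧ n < t ∧ ReadAt σ p q n
  let Ws : ℕ → V → Prop := fun t q => ∃ n, a ≤ n ∧ n < t ∧ WriteAt G σ p q n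
  let A : ℕ → Prop := fun t => ∃ n, a ≤ n ∧ n < t ∧ S2At G σ p n
  let B : ℕ → Prop := fun t => ∃ n, a ≤ n ∧ n < t ∧ S36At G T σ p n
  -- `Φ` pairs each program counter with the events that must already have happened. Its first two
  -- disjuncts exclude the start of a cycle, so at index `j` only the last one, which is permanent,
  -- can hold.
  let Φ : ℕ → Prop := fun t =>
    (∃ R, (σ t p).pc = PC.read R ∧ R ≠ G.neighborSet p ∧ ∀ q, G.Adj p q → q ∉ R → Rs t q) ∨
    ((σ t p).pc = PC.s2 ∧ G.neighborSet p ≠ ∅ ∧ ∀ q, G.Adj p q → Rs t q) ∨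
    ((σ t p).pc = PC.s36 ∧ (∀ q, G.Adj p q → Rs t q) ∧ A t) ∨
    (∃ R, (σ t p).pc = PC.write R ∧ (∀ q, G.Adj p q → Rs t q) ∧ A t ∧ B t ∧
      ∀ q, G.Adj p q → q ∉ R → Ws t q) ∨
    ((∀ q, G.Adj p q → Rs t q) ∧ A t ∧ B t ∧ ∀ q, G.Adj p q → Ws t q)
  have afterRead : ∀ t R q, a ≤ t → (σ t p).pc = PC.read R → ReadAt σ p q t →
      (∀ q, G.Adj p q → q ∉ R → Rs t q) → Φ (t + 1) := by
    intro t R q hat hpc hr hRs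
    obtain ⟨hq, hn⟩ := hr.pc_next hpc
    have hadj := h.adj_of_readAt hr
    have hRs' : ∀ q', G.Adj p q' → q' ∉ R \ {q} → Rs (t + 1) q' := by
      intro q' hq' hR
      by_cases hqq : q' = q
      · subst hqq; exact ⟨t, hat, by omega, hr⟩
      · exact mono (by omega) (hRs q' hq' fun hmem => hR ⟨hmem, hqq⟩)
    by_cases hR : R \ {q} = ∅
    · right; left
      rw [hR, readPC_empty] at hn
      refine ⟨hn, Set.nonempty_iff_ne_empty.1 ⟨q, hadj⟩, fun q' hq' => hRs' q' hq' ?_⟩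
      rw [hR]; exact Set.notMem_empty _
    · left
      rw [readPC_of_ne hR] at hn
      refine ⟨_, hn, fun hcon => ?_, hRs'⟩
      have : q ∈ R \ {q} := by rw [hcon]; exact hadj
      exact this.2 rfl
  have step : ∀ t, a ≤ t → Φ t → Φ (t + 1) := by
    intro t hat hΦ
    rcases h.event p t with he | ⟨q, hr⟩ | hs | hs | ⟨q, hw⟩
    · simp only [Φ, he]
      rcases hΦ with ⟨R, h1, h2, h3⟩ | ⟨h1, h2, h3⟩ | ⟨h1, h2, h3⟩ | ⟨R, h1, h2, h3, h4, h5⟩ |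
        ⟨h2, h3, h4, h5⟩
      · exact Or.inl ⟨R, h1, h2, fun q hq hR => mono (by omega) (h3 q hq hR)⟩
      · exact Or.inr (Or.inl ⟨h1, h2, fun q hq => mono (by omega) (h3 q hq)⟩)
      · exact Or.inr (Or.inr (Or.inl ⟨h1, fun q hq => mono (by omega) (h2 q hq),
          mono (by omega) h3⟩))
      · exact Or.inr (Or.inr (Or.inr (Or.inl ⟨R, h1, fun q hq => mono (by omega) (h2 q hq),
          mono (by omega) h3, mono (by omega) h4, fun q hq hR => mono (by omega) (h5 q hq hR)⟩)))
      · exact Or.inr (Or.inr (Or.inr (Or.inr ⟨fun q hq => mono (by omega) (h2 q hq),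
          mono (by omega) h3, mono (by omega) h4, fun q hq => mono (by omega) (h5 q hq)⟩)))
    · obtain ⟨R', hpc, -, -⟩ := id hr
      rcases hΦ with ⟨R, h1, h2, h3⟩ | ⟨h1, h2, h3⟩ | ⟨h1, h2, h3⟩ | ⟨R, h1, h2, h3, h4, h5⟩ |
        ⟨h2, h3, h4, h5⟩
      · exact afterRead t R q hat h1 hr h3
      · rw [hpc] at h1; cases h1
      · rw [hpc] at h1; cases h1
      · rw [hpc] at h1; cases h1
      · exact Or.inr (Or.inr (Or.inr (Or.inr ⟨fun q hq => mono (by omega) (h2 q hq),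
          mono (by omega) h3, mono (by omega) h4, fun q hq => mono (by omega) (h5 q hq)⟩)))
    · have hpc := hs.1
      rcases hΦ with ⟨R, h1, h2, h3⟩ | ⟨h1, h2, h3⟩ | ⟨h1, h2, h3⟩ | ⟨R, h1, h2, h3, h4, h5⟩ |
        ⟨h2, h3, h4, h5⟩
      · rw [hpc] at h1; cases h1
      · exact Or.inr (Or.inr (Or.inl ⟨hs.next.2.2.2.2, fun q hq => mono (by omega) (h3 q hq),
          ⟨t, hat, by omega, hs⟩⟩))
      · rw [hpc] at h1; cases h1
      · rw [hpc] at h1; cases h1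
      · exact Or.inr (Or.inr (Or.inr (Or.inr ⟨fun q hq => mono (by omega) (h2 q hq),
          mono (by omega) h3, mono (by omega) h4, fun q hq => mono (by omega) (h5 q hq)⟩)))
    · have hpc := hs.1
      rcases hΦ with ⟨R, h1, h2, h3⟩ | ⟨h1, h2, h3⟩ | ⟨h1, h2, h3⟩ | ⟨R, h1, h2, h3, h4, h5⟩ |
        ⟨h2, h3, h4, h5⟩
      · rw [hpc] at h1; cases h1
      · rw [hpc] at h1; cases h1
      · by_cases hN : G.neighborSet p = ∅
        · exact Or.inr (Or.inr (Or.inr (Or.inr ⟨fun q hq => mono (by omega) (h2 q hq),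
            mono (by omega) h3, ⟨t, hat, by omega, hs⟩, fun q hq => by
              have : q ∈ G.neighborSet p := hq
              rw [hN] at this
              exact absurd this (Set.notMem_empty _)⟩)))
        · refine Or.inr (Or.inr (Or.inr (Or.inl ⟨G.neighborSet p, ?_,
            fun q hq => mono (by omega) (h2 q hq), mono (by omega) h3, ⟨t, hat, by omega, hs⟩,
            fun q hq hR => absurd hq hR⟩)))
          rw [hs.pc_next, writePC_of_ne G p hN]
      · rw [hpc] at h1; cases h1
      · exact Or.inr (Or.inr (Or.inr (Or.inr ⟨fun q hq => mono (by omega) (h2 q hq),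
          mono (by omega) h3, mono (by omega) h4, fun q hq => mono (by omega) (h5 q hq)⟩)))
    · obtain ⟨R', hpc, -, -⟩ := id hw
      rcases hΦ with ⟨R, h1, h2, h3⟩ | ⟨h1, h2, h3⟩ | ⟨h1, h2, h3⟩ | ⟨R, h1, h2, h3, h4, h5⟩ |
        ⟨h2, h3, h4, h5⟩
      · rw [hpc] at h1; cases h1
      · rw [hpc] at h1; cases h1
      · rw [hpc] at h1; cases h1
      · obtain ⟨hq, hn⟩ := hw.pc_next h1
        have hWs : ∀ q', G.Adj p q' → q' ∉ R \ {q} → Ws (t + 1) q' := by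
          intro q' hq' hR
          by_cases hqq : q' = q
          · subst hqq; exact ⟨t, hat, by omega, hw⟩
          · exact mono (by omega) (h5 q' hq' fun hmem => hR ⟨hmem, hqq⟩)
        by_cases hR : R \ {q} = ∅
        · refine Or.inr (Or.inr (Or.inr (Or.inr ⟨fun q hq => mono (by omega) (h2 q hq),
            mono (by omega) h3, mono (by omega) h4, fun q' hq' => hWs q' hq' ?_⟩)))
          rw [hR]; exact Set.notMem_empty _
        · rw [writePC_of_ne G p hR] at hn
          exact Or.inr (Or.inr (Or.inr (Or.inl ⟨_, hn, fun q hq => mono (by omega) (h2 q hq),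
            mono (by omega) h3, mono (by omega) h4, hWs⟩)))
      · exact Or.inr (Or.inr (Or.inr (Or.inr ⟨fun q hq => mono (by omega) (h2 q hq),
          mono (by omega) h3, mono (by omega) h4, fun q hq => mono (by omega) (h5 q hq)⟩)))
  have first : ∀ t, i ≤ t → (σ t p).pc = startPC G p ∨ Φ t := by
    intro t ht
    induction t, ht using Nat.le_induction with
    | base => exact Or.inl hi
    | succ t ht ih =>
      rcases ih with ih | ih
      · rcases h.event p t with he | ⟨q, hr⟩ | hs | hs | ⟨q, hw⟩
        · rw [he]; exact Or.inl ih
        · right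
          obtain ⟨R, hpc, hq, -⟩ := id hr
          refine afterRead t R q (by omega) hpc hr ?_
          intro q' hq' hR
          exfalso
          rw [hpc, startPC] at ih
          by_cases hN : G.neighborSet p = ∅
          · rw [hN, readPC_empty] at ih; cases ih
          · rw [readPC_of_ne hN] at ih
            rw [(PC.read.injEq _ _).mp ih] at hR
            exact hR hq'
        · right
          refine Or.inr (Or.inr (Or.inl ⟨hs.next.2.2.2.2, fun q hq => ?_,
            ⟨t, by omega, by omega, hs⟩⟩))
          exfalso
          have hN : G.neighborSet p ≠ ∅ := Set.nonempty_iff_ne_empty.1 ⟨q, hq⟩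
          rw [hs.1, startPC, readPC_of_ne hN] at ih
          cases ih
        · exfalso
          rw [hs.1, startPC] at ih
          by_cases hN : G.neighborSet p = ∅
          · rw [hN, readPC_empty] at ih; cases ih
          · rw [readPC_of_ne hN] at ih; cases ih
        · exfalso
          obtain ⟨R, hpc, -, -⟩ := hw
          rw [hpc, startPC] at ih
          by_cases hN : G.neighborSet p = ∅
          · rw [hN, readPC_empty] at ih; cases ih
          · rw [readPC_of_ne hN] at ih; cases ih
      · exact Or.inr (step t (by omega) ih)
  have hΦm : Φ m := (first m him.le).resolve_left hm
  have hΦ : ∀ t, m ≤ t → Φ t := by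
    intro t ht
    induction t, ht using Nat.le_induction with
    | base => exact hΦm
    | succ t ht ih => exact step t (by omega) ih
  rcases hΦ j hmj.le with ⟨R, h1, h2, -⟩ | ⟨h1, h2, -⟩ | ⟨h1, -⟩ | ⟨R, h1, -⟩ | ⟨h2, h3, h4, h5⟩
  · exfalso
    rw [h1, startPC] at hj
    by_cases hN : G.neighborSet p = ∅
    · rw [hN, readPC_empty] at hj; cases hj
    · rw [readPC_of_ne hN] at hj
      exact h2 ((PC.read.injEq _ _).mp hj)
  · exfalso
    rw [h1, startPC, readPC_of_ne h2] at hj; cases hj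
  · exfalso
    rw [h1, startPC] at hj
    by_cases hN : G.neighborSet p = ∅
    · rw [hN, readPC_empty] at hj; cases hj
    · rw [readPC_of_ne hN] at hj; cases hj
  · exfalso
    rw [h1, startPC] at hj
    by_cases hN : G.neighborSet p = ∅
    · rw [hN, readPC_empty] at hj; cases hj
    · rw [readPC_of_ne hN] at hj; cases hj
  · exact ⟨fun q hq => mono hjb (h2 q hq), mono hjb h3, mono hjb h4,
      fun q hq => mono hjb (h5 q hq)⟩

end Rounds

/-! ### The latest event before an index -/

section LastBefore

open Classical in
/-- The greatest index below `e` with property `P` (and `0` if there is none). -/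
noncomputable def lastBefore (P : ℕ → Prop) (e : ℕ) : ℕ :=
  Nat.findGreatest (fun i => i < e ∧ P i) e

theorem lastBefore_spec {P : ℕ → Prop} {e i : ℕ} (hi : i < e) (hP : P i) :
    lastBefore P e < e ∧ P (lastBefore P e) := by
  classical
  exact Nat.findGreatest_spec (P := fun i => i < e ∧ P i) hi.le ⟨hi, hP⟩

theorem le_lastBefore {P : ℕ → Prop} {e i : ℕ} (hi : i < e) (hP : P i) :
    i ≤ lastBefore P e := by
  classical
  exact Nat.le_findGreatest (P := fun i => i < e ∧ P i) hi.le ⟨hi, hP⟩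

theorem lastBefore_mono (P : ℕ → Prop) : Monotone (lastBefore P) := by
  classical
  intro e e' hee'
  exact Nat.findGreatest_mono (fun i hi => ⟨hi.1.trans_le hee', hi.2⟩) hee'

end LastBefore

/-! ### Where images and echoes come from -/

section Sources

variable {V : Type*} {G : SimpleGraph V} {T : ℕ} {σ : ℕ → State V}

theorem IsComputation.image_succ (h : IsComputation G T σ) {p q : V} {i : ℕ}
    (hn : ¬ ReadAt σ p q i) : (σ (i + 1) p).image q = (σ i p).image q := by
  rcases h.event p i with he | ⟨q', hr⟩ | hs | hs | ⟨q', hw⟩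
  · rw [he]
  · refine hr.next.2.2.2.2 q ?_
    rintro rfl
    exact hn hr
  · exact hs.next.2.2.1 q
  · exact hs.next.1 q
  · exact hw.next.2.2.1 q

theorem IsComputation.reg_succ (h : IsComputation G T σ) {p q : V} {i : ℕ}
    (hn : ¬ WriteAt G σ p q i) : (σ (i + 1) p).reg q = (σ i p).reg q := by
  rcases h.event p i with he | ⟨q', hr⟩ | hs | hs | ⟨q', hw⟩
  · rw [he]
  · rw [hr.next.2.2.1]
  · rw [hs.next.2.2.2.1]
  · rw [hs.next.2]
  · refine hw.next.2.2.2.2 q ?_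
    rintro rfl
    exact hn hw

theorem IsComputation.image_eq (h : IsComputation G T σ) {p q : V} {i e : ℕ} (hi : i < e)
    (hr : ReadAt σ p q i) :
    (σ e p).image q = (σ (lastBefore (ReadAt σ p q) e) q).reg p := by
  obtain ⟨hlt, hread⟩ := lastBefore_spec hi hr
  have key : ∀ t, lastBefore (ReadAt σ p q) e + 1 ≤ t → t ≤ e →
      (σ t p).image q = (σ (lastBefore (ReadAt σ p q) e) q).reg p := by
    intro t ht
    induction t, ht using Nat.le_induction with
    | base => exact fun _ => hread.next.2.2.2.1
    | succ t ht ih =>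
      intro hte
      rw [h.image_succ, ih (by omega)]
      intro hcon
      have := le_lastBefore (show t < e by omega) hcon
      omega
  exact key e hlt le_rfl

theorem IsComputation.reg_eq (h : IsComputation G T σ) {p q : V} {i e : ℕ} (hi : i < e)
    (hr : WriteAt G σ p q i) :
    (σ e p).reg q = (σ (lastBefore (WriteAt G σ p q) e) p).output q := by
  obtain ⟨hlt, hwrite⟩ := lastBefore_spec hi hr
  have key : ∀ t, lastBefore (WriteAt G σ p q) e + 1 ≤ t → t ≤ e →
      (σ t p).reg q = (σ (lastBefore (WriteAt G σ p q) e) p).output q := by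
    intro t ht
    induction t, ht using Nat.le_induction with
    | base => exact fun _ => hwrite.next.2.2.2.1
    | succ t ht ih =>
      intro hte
      rw [h.reg_succ, ih (by omega)]
      intro hcon
      have := le_lastBefore (show t < e by omega) hcon
      omega
  exact key e hlt le_rfl

/-- The index of the write by `q` from which the images that `p` holds of `q` at index `e` come. -/
noncomputable def source (G : SimpleGraph V) (σ : ℕ → State V) (p q : V) (e : ℕ) : ℕ :=
  lastBefore (WriteAt G σ q p) (lastBefore (ReadAt σ p q) e)

theorem source_mono (p q : V) : Monotone (source G σ p q) :=
  (lastBefore_mono _).comp (lastBefore_mono _)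

theorem execS2_w_le_y {p q : V} {c : Config V} (hq : G.Adj p q) :
    (execS2 G p c).w ≤ c.y q + 1 := by
  rcases execS2_w_cases G p c with ⟨h1, -, h2⟩ | ⟨h1, -, h2⟩ | ⟨q', -, -, h2, h1⟩ <;>
    have := h2 q hq <;> omega

theorem image_y {p q : V} {i j : ℕ} {p' q' : V}
    (h : (σ i p).image q = (σ j p').image q') : (σ i p).y q = (σ j p').y q' :=
  congrArg Reg.w h

theorem image_x {p q : V} {i j : ℕ} {p' q' : V}
    (h : (σ i p).image q = (σ j p').image q') : (σ i p).x q = (σ j p').x q' :=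
  congrArg Reg.clock h

variable [Finite V]

theorem IsComputation.exists_readAt (h : IsComputation G T σ) {p q : V} (hpq : G.Adj p q)
    (k : ℕ) : ∃ i, roundEnd G σ k ≤ i ∧ i < roundEnd G σ (k + 1) ∧ ReadAt σ p q i :=
  ((h.completesCycle_roundEnd k p).events h).1 q hpq

theorem IsComputation.exists_writeAt (h : IsComputation G T σ) {p q : V} (hpq : G.Adj p q)
    (k : ℕ) : ∃ i, roundEnd G σ k ≤ i ∧ i < roundEnd G σ (k + 1) ∧ WriteAt G σ p q i :=
  ((h.completesCycle_roundEnd k p).events h).2.2.2 q hpq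

theorem IsComputation.exists_s2At (h : IsComputation G T σ) (p : V) (k : ℕ) :
    ∃ i, roundEnd G σ k ≤ i ∧ i < roundEnd G σ (k + 1) ∧ S2At G σ p i :=
  ((h.completesCycle_roundEnd k p).events h).2.1

theorem IsComputation.exists_s36At (h : IsComputation G T σ) (p : V) (k : ℕ) :
    ∃ i, roundEnd G σ k ≤ i ∧ i < roundEnd G σ (k + 1) ∧ S36At G T σ p i :=
  ((h.completesCycle_roundEnd k p).events h).2.2.1

theorem IsComputation.lastRead_spec (h : IsComputation G T σ) {p q : V} (hpq : G.Adj p q)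
    {k e : ℕ} (he : roundEnd G σ (k + 1) ≤ e) :
    roundEnd G σ k ≤ lastBefore (ReadAt σ p q) e ∧ lastBefore (ReadAt σ p q) e < e ∧
      ReadAt σ p q (lastBefore (ReadAt σ p q) e) ∧
      (σ e p).image q = (σ (lastBefore (ReadAt σ p q) e) q).reg p := by
  obtain ⟨i, h1, h2, h3⟩ := h.exists_readAt hpq k
  have hie := h2.trans_le he
  obtain ⟨h4, h5⟩ := lastBefore_spec hie h3
  exact ⟨h1.trans (le_lastBefore hie h3), h4, h5, h.image_eq hie h3⟩

theorem IsComputation.lastWrite_spec (h : IsComputation G T σ) {p q : V} (hpq : G.Adj p q)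
    {k e : ℕ} (he : roundEnd G σ (k + 1) ≤ e) :
    roundEnd G σ k ≤ lastBefore (WriteAt G σ p q) e ∧ lastBefore (WriteAt G σ p q) e < e ∧
      WriteAt G σ p q (lastBefore (WriteAt G σ p q) e) ∧
      (σ e p).reg q = (σ (lastBefore (WriteAt G σ p q) e) p).output q := by
  obtain ⟨i, h1, h2, h3⟩ := h.exists_writeAt hpq k
  have hie := h2.trans_le he
  obtain ⟨h4, h5⟩ := lastBefore_spec hie h3
  exact ⟨h1.trans (le_lastBefore hie h3), h4, h5, h.reg_eq hie h3⟩

theorem IsComputation.source_spec (h : IsComputation G T σ) {p q : V} (hpq : G.Adj p q)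
    {k e : ℕ} (he : roundEnd G σ (k + 2) ≤ e) :
    roundEnd G σ k ≤ source G σ p q e ∧ source G σ p q e < lastBefore (ReadAt σ p q) e ∧
      lastBefore (ReadAt σ p q) e < e ∧ WriteAt G σ q p (source G σ p q e) ∧
      (σ e p).image q = (σ (source G σ p q e) q).output p := by
  obtain ⟨h1, h2, -, h4⟩ := h.lastRead_spec hpq he
  obtain ⟨h5, h6, h7, h8⟩ := h.lastWrite_spec hpq.symm h1
  exact ⟨h5, h6, h2, h7, h4.trans h8⟩

/-- Each hop of information costs one round: after a full round, the write that produced the present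
contents lies inside the period in which `P` is known. -/
theorem IsComputation.flow_reg (h : IsComputation G T σ) {p q : V} (hpq : G.Adj p q) {k b : ℕ}
    {P : Reg → Prop}
    (hP : ∀ i, roundEnd G σ k ≤ i → i < b → WriteAt G σ p q i → P ((σ i p).output q)) {t : ℕ}
    (ht : roundEnd G σ (k + 1) ≤ t) (htb : t ≤ b) : P ((σ t p).reg q) := by
  obtain ⟨h1, h2, h3, h4⟩ := h.lastWrite_spec hpq ht
  rw [h4]
  exact hP _ h1 (by omega) h3

theorem IsComputation.flow_image (h : IsComputation G T σ) {p q : V} (hpq : G.Adj p q)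
    {k b : ℕ} {P : Reg → Prop}
    (hP : ∀ i, roundEnd G σ k ≤ i → i < b → P ((σ i q).reg p)) {t : ℕ}
    (ht : roundEnd G σ (k + 1) ≤ t) (htb : t ≤ b) : P ((σ t p).image q) := by
  obtain ⟨h1, h2, h3, h4⟩ := h.lastRead_spec hpq ht
  rw [h4]
  exact hP _ h1 (by omega)

/-- An echo takes four hops: `p` writes, `q` reads, `q` writes back, `p` reads. -/
theorem IsComputation.flow_echo (h : IsComputation G T σ) {p q : V} (hpq : G.Adj p q)
    {k b : ℕ} {P : ℕ → ℕ → Prop}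
    (hP : ∀ i, roundEnd G σ k ≤ i → i < b → P (σ i p).clock (σ i p).w) {t : ℕ}
    (ht : roundEnd G σ (k + 4) ≤ t) (htb : t ≤ b) : P ((σ t p).r q) ((σ t p).s q) :=
  h.flow_image (P := fun m => P m.x m.y) hpq (k := k + 3) (fun _ h1 h2 =>
    h.flow_reg (P := fun m => P m.x m.y) hpq.symm (k := k + 2) (b := b) (fun _ h1 h2 _ =>
      h.flow_image (P := fun m => P m.clock m.w) hpq.symm (k := k + 1) (b := b) (fun _ h1 h2 =>
        h.flow_reg (P := fun m => P m.clock m.w) hpq (k := k) (b := b) (fun i h1 h2 _ =>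
          hP i h1 h2) h1 h2.le) h1 h2.le) h1 h2.le) ht htb

/-- Four rounds bring the echo of a constant value back; the fifth supplies an execution of `S2`. -/
theorem IsComputation.exists_wEcho (h : IsComputation G T σ) {p : V} {k v : ℕ}
    (hv : ∀ t, roundEnd G σ k ≤ t → t ≤ roundEnd G σ (k + 5) → (σ t p).w = v) :
    ∃ i, roundEnd G σ (k + 4) ≤ i ∧ i < roundEnd G σ (k + 5) ∧ S2At G σ p i ∧
      wEcho G p (σ i p) := by
  have : Nonempty V := ⟨p⟩
  obtain ⟨i, h1, h2, h3⟩ := h.exists_s2At p (k + 4)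
  refine ⟨i, h1, h2, h3, fun q hq => ?_⟩
  rw [hv i ((h.roundEnd_strictMono.monotone (by omega)).trans h1) h2.le]
  exact (h.flow_echo (P := fun _ w => w = v) hq (fun i h1 h2 => hv i h1 h2.le) h1 h2.le).symm

theorem IsComputation.exists_cEcho (h : IsComputation G T σ) {p : V} {k v : ℕ}
    (hv : ∀ t, roundEnd G σ k ≤ t → t ≤ roundEnd G σ (k + 5) → (σ t p).clock = v) :
    ∃ i, roundEnd G σ (k + 4) ≤ i ∧ i < roundEnd G σ (k + 5) ∧ S36At G T σ p i ∧
      cEcho G p (σ i p) := by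
  have : Nonempty V := ⟨p⟩
  obtain ⟨i, h1, h2, h3⟩ := h.exists_s36At p (k + 4)
  refine ⟨i, h1, h2, h3, fun q hq => ?_⟩
  rw [hv i ((h.roundEnd_strictMono.monotone (by omega)).trans h1) h2.le]
  exact (h.flow_echo (P := fun c _ => c = v) hq (fun i h1 h2 => hv i h1 h2.le) h1 h2.le).symm

/-- Between the execution of `S2` and the end of the cycle, `w` is at most one more than the
images of the neighbours' `w`. -/
theorem IsComputation.w_le_y_add_one (h : IsComputation G T σ) {p q : V} (hq : G.Adj p q)
    {t : ℕ} (ht : roundEnd G σ 1 ≤ t)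
    (hpc : (σ t p).pc = PC.s36 ∨ ∃ R, (σ t p).pc = PC.write R) :
    (σ t p).w ≤ (σ t p).y q + 1 := by
  obtain ⟨i, -, hi, hs⟩ := h.exists_s2At p 0
  have key : ∀ t, i + 1 ≤ t → ((σ t p).pc = PC.s36 ∨ ∃ R, (σ t p).pc = PC.write R) →
      (σ t p).w ≤ (σ t p).y q + 1 := by
    have hS2 : ∀ j, S2At G σ p j → (σ (j + 1) p).w ≤ (σ (j + 1) p).y q + 1 := by
      intro j hj
      rw [hj.next.2.1, image_y (hj.next.2.2.1 q)]
      exact execS2_w_le_y hq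
    intro t ht
    induction t, ht using Nat.le_induction with
    | base => exact fun _ => hS2 i hs
    | succ t ht ih =>
      intro hpc
      rcases h.event p t with he | ⟨q', hr⟩ | hs | hs | ⟨q', hw⟩
      · rw [he] at hpc ⊢; exact ih hpc
      · exfalso
        obtain ⟨R, hR, -, -⟩ := id hr
        rw [(hr.pc_next hR).2] at hpc
        by_cases hE : R \ {q'} = ∅
        · rw [hE, readPC_empty] at hpc
          rcases hpc with hpc | ⟨R, hpc⟩ <;> cases hpc
        · rw [readPC_of_ne hE] at hpc
          rcases hpc with hpc | ⟨R, hpc⟩ <;> cases hpc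
      · exact hS2 t hs
      · have := ih (Or.inl hs.1)
        rw [image_y (hs.next.1 q)]
        rcases hs.cases with ⟨-, h2, -⟩ | ⟨-, h2, -⟩ | ⟨-, h2, -⟩ | ⟨-, h2, -⟩ <;> omega
      · obtain ⟨R, hR, -, -⟩ := id hw
        rw [hw.next.2.1, image_y (hw.next.2.2.1 q)]
        exact ih (Or.inr ⟨R, hR⟩)
  exact key t (by rw [zero_add] at hi; omega) hpc

end Sources

theorem persists {P : ℕ → Prop} {a b : ℕ} (h : ∀ t, a ≤ t → t < b → P t → P (t + 1)) {s : ℕ}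
    (hs : a ≤ s) (hP : P s) {t : ℕ} (hst : s ≤ t) (htb : t ≤ b) : P t := by
  induction t, hst using Nat.le_induction with
  | base => exact hP
  | succ t ht ih => exact h t (by omega) (by omega) (ih (by omega))

/-! ### Small `w` certifies a small clock -/

section Grounded

variable {V : Type*} {G : SimpleGraph V} {T : ℕ} {σ : ℕ → State V}

/-- Either `clock ≤ w`, or `w` is at least `m`. -/
def Level (m c w : ℕ) : Prop := c ≤ w ∨ m ≤ w

/-- `Level m` for the variables of `p`; between `S2` and the multiway `if` it is enough that `w` has
just dropped because of a neighbour whose image satisfies it. -/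
def OwnLevel (G : SimpleGraph V) (m : ℕ) (p : V) (c : Config V) : Prop :=
  c.clock ≤ c.w ∨ m ≤ c.w ∨
    (c.pc = PC.s36 ∧ ∃ q, G.Adj p q ∧ c.y q + 1 = c.w ∧ c.x q ≤ c.y q)

/-- `Level m` holds for all variables, registers and images. -/
def AllLevel (G : SimpleGraph V) (m : ℕ) (σ : State V) : Prop :=
  ∀ p, OwnLevel G m p (σ p) ∧ ∀ q, G.Adj p q →
    Level m ((σ p).reg q).clock ((σ p).reg q).w ∧ Level m ((σ p).x q) ((σ p).y q)

theorem ownLevel_iff {m : ℕ} {p : V} {c : Config V} (h : c.pc ≠ PC.s36) :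
    OwnLevel G m p c ↔ Level m c.clock c.w := by
  simp [OwnLevel, Level, h]

theorem WriteAt.pc_ne {p q : V} {i : ℕ} (h : WriteAt G σ p q i) : (σ i p).pc ≠ PC.s36 := by
  obtain ⟨R, hR, -⟩ := h
  rw [hR]
  exact nofun

/-- Only following a neighbour can lower `w` below the clock. That neighbour's image is itself
grounded, which gives the pending clause of `OwnLevel` or a new `w` of at least `m + 1`. -/
theorem S2At.ownLevel_next {p : V} {i m : ℕ} (hs : S2At G σ p i)
    (hw : (σ i p).w ≤ 3 * G.diam + 1)
    (himg : ∀ q, G.Adj p q → Level m ((σ i p).x q) ((σ i p).y q))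
    (hown : (σ i p).clock ≤ (σ i p).w ∨ m + 1 ≤ (σ i p).w ∨
      m ≤ (σ i p).w ∧ m ≤ 3 * G.diam ∧ wEcho G p (σ i p)) :
    OwnLevel G (m + 1) p (σ (i + 1) p) := by
  have h1 := hs.next.1
  have h2 := hs.next.2.1
  rcases execS2_w_cases G p (σ i p) with ⟨h3, h4, -⟩ | ⟨h3, h4, -⟩ | ⟨q, hq, hlt, -, h3⟩
  · rcases hown with h | h | h
    · left; omega
    · right; left; omega
    · exact absurd h.2.2 h4
  · rcases hown with h | h | h
    · left; omega
    · right; left; omega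
    · right; left; omega
  · have h5 := image_y (hs.next.2.2.1 q)
    have h6 := image_x (hs.next.2.2.1 q)
    rcases himg q hq with h | h
    · exact Or.inr (Or.inr ⟨hs.next.2.2.2.2, q, hq, by omega, by omega⟩)
    · right; left; omega

/-- The multiway `if` discharges the pending clause. If the clock is left alone despite a gap, then
`wBig` holds; without a gap, `clock ≤ x q + 1 ≤ y q + 1 = w`. -/
theorem S36At.level_next {p : V} {i m : ℕ} (hs : S36At G T σ p i) (hm : m ≤ 3 * G.diam + 1)
    (hown : OwnLevel G m p (σ i p)) : Level m (σ (i + 1) p).clock (σ (i + 1) p).w := by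
  unfold Level
  rcases hs.cases with ⟨h1, h2, -, h3, -⟩ | ⟨h1, h2, -⟩ | ⟨h1, h2, -⟩ | ⟨h1, h2, h3, -⟩
  · unfold wBigr at h3
    omega
  · omega
  · omega
  · rcases hown with h | h | ⟨-, q, hq, h4, h5⟩
    · omega
    · omega
    · by_cases hg : gap G p (σ i p)
      · have := (h3 hg).2
        unfold wBig at this
        omega
      · have := not_gap_le hg hq
        omega

theorem IsComputation.ownLevel_succ (h : IsComputation G T σ) {p : V} {i m : ℕ}
    (hm : m ≤ 3 * G.diam) (himg : ∀ q, G.Adj p q → Level m ((σ i p).x q) ((σ i p).y q))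
    (hown : OwnLevel G (m + 1) p (σ i p)) : OwnLevel G (m + 1) p (σ (i + 1) p) := by
  rcases h.event p i with he | ⟨q, hr⟩ | hs | hs | ⟨q, hw⟩
  · rw [he]; exact hown
  · obtain ⟨R, hR, -, -⟩ := id hr
    rw [ownLevel_iff (by rw [hR]; exact nofun)] at hown
    unfold OwnLevel
    rw [hr.next.1, hr.next.2.1]
    exact hown.imp_right Or.inl
  · rw [ownLevel_iff (by rw [hs.1]; exact nofun)] at hown
    exact hs.ownLevel_next (h.w_le p i) himg (hown.imp_right Or.inl)
  · exact (hs.level_next (by omega) hown).imp_right Or.inl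
  · rw [ownLevel_iff hw.pc_ne] at hown
    unfold OwnLevel
    rw [hw.next.1, hw.next.2.1]
    exact hown.imp_right Or.inl

variable [Finite V]

/-- A process violating level `m + 1` throughout five rounds would have `w = m` all that time, hence
receive its echo, and `S2` would end the violation. Two more rounds carry the new level to registers
and images. -/
theorem IsComputation.allLevel_succ (h : IsComputation G T σ) {m k : ℕ} (hm : m ≤ 3 * G.diam)
    (hall : ∀ t, roundEnd G σ k ≤ t → AllLevel G m (σ t)) {t : ℕ}
    (ht : roundEnd G σ (k + 7) ≤ t) : AllLevel G (m + 1) (σ t) := by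
  rcases isEmpty_or_nonempty V with hV | hV
  · exact fun p => isEmptyElim p
  have hmono := h.roundEnd_strictMono.monotone
  have hex : ∀ p, ∃ s, roundEnd G σ k ≤ s ∧ s ≤ roundEnd G σ (k + 5) ∧
      OwnLevel G (m + 1) p (σ s p) := by
    intro p
    by_contra! hcon
    have hw : ∀ s, roundEnd G σ k ≤ s → s ≤ roundEnd G σ (k + 5) → (σ s p).w = m := by
      intro s h1 h2
      have h3 := hcon s h1 h2
      have h4 := (hall s h1 p).1
      unfold OwnLevel at h3 h4
      push Not at h3
      rcases h4 with h4 | h4 | ⟨h4, q, hq, h5, h6⟩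
      · omega
      · omega
      · exact absurd h6 (not_le.2 (h3.2.2 h4 q hq h5))
    obtain ⟨i, h1, h2, h3, h4⟩ := h.exists_wEcho hw
    have hki : roundEnd G σ k ≤ i := (hmono (by omega)).trans h1
    exact hcon (i + 1) (by omega) h2 (h3.ownLevel_next (h.w_le p i)
      (fun q hq => ((hall i hki p).2 q hq).2) (Or.inr (Or.inr ⟨(hw i hki h2.le).ge, hm, h4⟩)))
  have hown : ∀ p t, roundEnd G σ (k + 5) ≤ t → OwnLevel G (m + 1) p (σ t p) := by
    intro p t ht
    obtain ⟨s, h1, h2, h3⟩ := hex p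
    exact persists (P := fun t => OwnLevel G (m + 1) p (σ t p)) (a := roundEnd G σ k) (b := t)
      (fun t h1 _ h3 => h.ownLevel_succ hm (fun q hq => ((hall t h1 p).2 q hq).2) h3)
      h1 h3 (h2.trans ht) le_rfl
  have hreg : ∀ p q, G.Adj p q → ∀ t, roundEnd G σ (k + 6) ≤ t →
      Level (m + 1) ((σ t p).reg q).clock ((σ t p).reg q).w := fun p q hpq t ht =>
    h.flow_reg (P := fun m' => Level (m + 1) m'.clock m'.w) hpq (fun i h1 _ hw =>
      (ownLevel_iff hw.pc_ne).1 (hown p i h1)) ht le_rfl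
  exact fun p => ⟨hown p t ((hmono (by omega)).trans ht), fun q hpq =>
    ⟨hreg p q hpq t ((hmono (by omega)).trans ht),
      h.flow_image (P := fun m' => Level (m + 1) m'.clock m'.w) hpq
        (fun i h1 _ => hreg q p hpq.symm i h1) ht le_rfl⟩⟩

theorem IsComputation.allLevel (h : IsComputation G T σ) {m : ℕ} (hm : m ≤ 3 * G.diam + 1)
    {t : ℕ} (ht : roundEnd G σ (7 * m) ≤ t) : AllLevel G m (σ t) := by
  induction m generalizing t with
  | zero =>
    exact fun p => ⟨Or.inr (Or.inl (Nat.zero_le _)),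
      fun q _ => ⟨Or.inr (Nat.zero_le _), Or.inr (Nat.zero_le _)⟩⟩
  | succ m ih => exact h.allLevel_succ (by omega) (fun t ht => ih (by omega) ht) ht

end Grounded

/-! ### Progress in the absence of resets -/

section Liveness

variable {V : Type*} {G : SimpleGraph V} {T : ℕ} {σ : ℕ → State V} [Finite V]

/-- In the state `σ`, `w` and all copies of it are at least `m`. -/
def WLevel (G : SimpleGraph V) (m : ℕ) (σ : State V) : Prop :=
  ∀ p, m ≤ (σ p).w ∧ ∀ q, G.Adj p q → m ≤ ((σ p).reg q).w ∧ m ≤ (σ p).y q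

/-- In the state `σ`, `clock` and all copies of it are at least `m`. -/
def ClockLevel (G : SimpleGraph V) (m : ℕ) (σ : State V) : Prop :=
  ∀ p, m ≤ (σ p).clock ∧ ∀ q, G.Adj p q → m ≤ ((σ p).reg q).clock ∧ m ≤ (σ p).x q

/-- Following a neighbour with image at least `m` leaves `w` at least `m + 1`, so without resets
that bound is never lost once gained; a `w` stuck at `m` is echoed and raised. -/
theorem IsComputation.wLevel_succ (h : IsComputation G T σ) {m k b : ℕ} (hm : m ≤ 3 * G.diam)
    (hres : ∀ p i, roundEnd G σ k ≤ i → i < b → ¬ ResetAt G T σ p i)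
    (hall : ∀ t, roundEnd G σ k ≤ t → t ≤ b → WLevel G m (σ t)) {t : ℕ}
    (ht : roundEnd G σ (k + 7) ≤ t) (htb : t ≤ b) : WLevel G (m + 1) (σ t) := by
  rcases isEmpty_or_nonempty V with hV | hV
  · exact fun p => isEmptyElim p
  have hmono := h.roundEnd_strictMono.monotone
  have h57 : roundEnd G σ (k + 5) ≤ roundEnd G σ (k + 7) := hmono (by omega)
  have hstep : ∀ p t, roundEnd G σ k ≤ t → t < b → m + 1 ≤ (σ t p).w →
      m + 1 ≤ (σ (t + 1) p).w := by
    intro p t h1 h2 h3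
    rcases h.event p t with he | ⟨q, hr⟩ | hs | hs | ⟨q, hw⟩
    · rw [he]; exact h3
    · rw [hr.next.2.1]; exact h3
    · rw [hs.next.2.1]
      rcases execS2_w_cases G p (σ t p) with ⟨h4, -⟩ | ⟨h4, -⟩ | ⟨q, hq, -, -, h4⟩
      · omega
      · omega
      · have := (((hall t h1 h2.le) p).2 q hq).2
        omega
    · rcases hs.cases with ⟨-, h4, -⟩ | ⟨-, -, h4⟩ | ⟨-, h4, -⟩ | ⟨-, h4, -⟩
      · omega
      · exact absurd h4 (hres p t h1 h2)
      · omega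
      · omega
    · rw [hw.next.2.1]; exact h3
  have hex : ∀ p, ∃ s, roundEnd G σ k ≤ s ∧ s ≤ roundEnd G σ (k + 5) ∧ m + 1 ≤ (σ s p).w := by
    intro p
    by_contra! hcon
    have hw : ∀ s, roundEnd G σ k ≤ s → s ≤ roundEnd G σ (k + 5) → (σ s p).w = m := by
      intro s h1 h2
      have h3 := hcon s h1 h2
      have h4 := (hall s h1 (by omega) p).1
      omega
    obtain ⟨i, h1, h2, h3, h4⟩ := h.exists_wEcho hw
    have hki : roundEnd G σ k ≤ i := (hmono (by omega)).trans h1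
    have h5 := hcon (i + 1) (by omega) h2
    have h6 := hw i hki h2.le
    rw [h3.next.2.1] at h5
    rcases execS2_w_cases G p (σ i p) with ⟨-, h7, -⟩ | ⟨h7, -⟩ | ⟨q, hq, h8, -, h7⟩
    · exact h7 h4
    · omega
    · have := ((hall i hki (by omega) p).2 q hq).2
      omega
  have hown : ∀ p t, roundEnd G σ (k + 5) ≤ t → t ≤ b → m + 1 ≤ (σ t p).w := by
    intro p t ht htb
    obtain ⟨s, h1, h2, h3⟩ := hex p
    exact persists (P := fun t => m + 1 ≤ (σ t p).w) (hstep p) h1 h3 (h2.trans ht) htb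
  have hreg : ∀ p q, G.Adj p q → ∀ t, roundEnd G σ (k + 6) ≤ t → t ≤ b →
      m + 1 ≤ ((σ t p).reg q).w := fun p q hpq t ht htb =>
    h.flow_reg (P := fun r => m + 1 ≤ r.w) hpq (fun i h1 h2 _ => hown p i h1 (by omega)) ht htb
  exact fun p => ⟨hown p t (h57.trans ht) htb, fun q hpq =>
    ⟨hreg p q hpq t ((hmono (by omega)).trans ht) htb,
      h.flow_image (P := fun r => m + 1 ≤ r.w) hpq
        (fun i h1 h2 => hreg q p hpq.symm i h1 (by omega)) ht htb⟩⟩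

theorem IsComputation.wLevel (h : IsComputation G T σ) {m k b : ℕ} (hm : m ≤ 3 * G.diam + 1)
    (hres : ∀ p i, roundEnd G σ k ≤ i → i < b → ¬ ResetAt G T σ p i) {t : ℕ}
    (ht : roundEnd G σ (k + 7 * m) ≤ t) (htb : t ≤ b) : WLevel G m (σ t) := by
  rcases isEmpty_or_nonempty V with hV | hV
  · exact fun p => isEmptyElim p
  have hmono := h.roundEnd_strictMono.monotone
  induction m generalizing t with
  | zero => exact fun p => ⟨Nat.zero_le _, fun q _ => ⟨Nat.zero_le _, Nat.zero_le _⟩⟩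
  | succ m ih =>
    exact h.wLevel_succ (by omega) (fun p i h1 h2 => hres p i ((hmono (by omega)).trans h1) h2)
      (fun t ht htb => ih (by omega) ht htb) ht htb

/-- With `w` at its maximum, `S5` is disabled and `wBigr` holds. A clock stuck at the minimum `m` is
echoed and does not exceed `cMin`, so it is incremented with or without a gap, as resets are
excluded. -/
theorem IsComputation.clockLevel_succ (h : IsComputation G T σ) {m k b : ℕ} (hm : m < T)
    (hres : ∀ p i, roundEnd G σ k ≤ i → i < b → ¬ ResetAt G T σ p i)
    (hw : ∀ p t, roundEnd G σ k ≤ t → t ≤ b → 3 * G.diam + 1 ≤ (σ t p).w)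
    (hall : ∀ t, roundEnd G σ k ≤ t → t ≤ b → ClockLevel G m (σ t)) {t : ℕ}
    (ht : roundEnd G σ (k + 7) ≤ t) (htb : t ≤ b) : ClockLevel G (m + 1) (σ t) := by
  rcases isEmpty_or_nonempty V with hV | hV
  · exact fun p => isEmptyElim p
  have hmono := h.roundEnd_strictMono.monotone
  have h57 : roundEnd G σ (k + 5) ≤ roundEnd G σ (k + 7) := hmono (by omega)
  have hstep : ∀ p t, roundEnd G σ k ≤ t → t < b → m + 1 ≤ (σ t p).clock →
      m + 1 ≤ (σ (t + 1) p).clock := by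
    intro p t h1 h2 h3
    rcases h.event p t with he | ⟨q, hr⟩ | hs | hs | ⟨q, hw⟩
    · rw [he]; exact h3
    · rw [hr.next.1]; exact h3
    · rw [hs.next.1]; exact h3
    · have := hw p t h1 h2.le
      rcases hs.cases with ⟨h4, -⟩ | ⟨-, -, h4⟩ | h4 | ⟨h4, -⟩
      · omega
      · exact absurd h4 (hres p t h1 h2)
      · omega
      · omega
    · rw [hw.next.1]; exact h3
  have hex : ∀ p, ∃ s, roundEnd G σ k ≤ s ∧ s ≤ roundEnd G σ (k + 5) ∧
      m + 1 ≤ (σ s p).clock := by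
    intro p
    by_contra! hcon
    have hc : ∀ s, roundEnd G σ k ≤ s → s ≤ roundEnd G σ (k + 5) → (σ s p).clock = m := by
      intro s h1 h2
      have h3 := hcon s h1 h2
      have h4 := (hall s h1 (by omega) p).1
      omega
    obtain ⟨i, h1, h2, h3, h4⟩ := h.exists_cEcho hc
    have hki : roundEnd G σ k ≤ i := (hmono (by omega)).trans h1
    have h5 := hcon (i + 1) (by omega) h2
    have h6 := hc i hki h2.le
    have h7 := hw p i hki (by omega)
    rcases h3.cases with ⟨h8, -⟩ | ⟨-, -, h8⟩ | h8 | ⟨-, -, -, h8⟩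
    · omega
    · exact hres p i hki (by omega) h8
    · omega
    · have h9 := (h8 h4 (Or.inl h7) fun q hq => by
        rw [h6]; exact ((hall i hki (by omega) p).2 q hq).2).2
      omega
  have hown : ∀ p t, roundEnd G σ (k + 5) ≤ t → t ≤ b → m + 1 ≤ (σ t p).clock := by
    intro p t ht htb
    obtain ⟨s, h1, h2, h3⟩ := hex p
    exact persists (P := fun t => m + 1 ≤ (σ t p).clock) (hstep p) h1 h3 (h2.trans ht) htb
  have hreg : ∀ p q, G.Adj p q → ∀ t, roundEnd G σ (k + 6) ≤ t → t ≤ b →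
      m + 1 ≤ ((σ t p).reg q).clock := fun p q hpq t ht htb =>
    h.flow_reg (P := fun r => m + 1 ≤ r.clock) hpq (fun i h1 h2 _ => hown p i h1 (by omega))
      ht htb
  exact fun p => ⟨hown p t (h57.trans ht) htb, fun q hpq =>
    ⟨hreg p q hpq t ((hmono (by omega)).trans ht) htb,
      h.flow_image (P := fun r => m + 1 ≤ r.clock) hpq
        (fun i h1 h2 => hreg q p hpq.symm i h1 (by omega)) ht htb⟩⟩

theorem IsComputation.clockLevel (h : IsComputation G T σ) {m k b : ℕ} (hm : m ≤ T)
    (hres : ∀ p i, roundEnd G σ k ≤ i → i < b → ¬ ResetAt G T σ p i)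
    (hw : ∀ p t, roundEnd G σ k ≤ t → t ≤ b → 3 * G.diam + 1 ≤ (σ t p).w) {t : ℕ}
    (ht : roundEnd G σ (k + 7 * m) ≤ t) (htb : t ≤ b) : ClockLevel G m (σ t) := by
  rcases isEmpty_or_nonempty V with hV | hV
  · exact fun p => isEmptyElim p
  have hmono := h.roundEnd_strictMono.monotone
  induction m generalizing t with
  | zero => exact fun p => ⟨Nat.zero_le _, fun q _ => ⟨Nat.zero_le _, Nat.zero_le _⟩⟩
  | succ m ih =>
    exact h.clockLevel_succ (by omega)
      (fun p i h1 h2 => hres p i ((hmono (by omega)).trans h1) h2)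
      (fun p i h1 h2 => hw p i ((hmono (by omega)).trans h1) h2)
      (fun t ht htb => ih (by omega) ht htb) ht htb

/-- A stretch of sufficiently many rounds without a reset ends in a timer-final state. -/
theorem IsComputation.timerFinal_of_noReset (h : IsComputation G T σ)
    (hD : G.diam = 0 → ∀ p q, ¬ G.Adj p q) {k : ℕ}
    (hres : ∀ p i, roundEnd G σ k ≤ i →
      i < roundEnd G σ (k + 7 * (3 * G.diam + 1) + 7 * T + 4) → ¬ ResetAt G T σ p i) :
    TimerFinal G T (σ (roundEnd G σ (k + 7 * (3 * G.diam + 1) + 7 * T + 4))) := by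
  rcases isEmpty_or_nonempty V with hV | hV
  · exact ⟨fun p => isEmptyElim p, fun p => isEmptyElim p⟩
  have hmono := h.roundEnd_strictMono.monotone
  -- Seven rounds per unit of `w`, seven per unit of clock, and four for the final values to pass
  -- through registers, images and echoes.
  set b := roundEnd G σ (k + 7 * (3 * G.diam + 1) + 7 * T + 4)
  have hw : ∀ p t, roundEnd G σ (k + 7 * (3 * G.diam + 1)) ≤ t → t ≤ b →
      (σ t p).w = 3 * G.diam + 1 := fun p t h1 h2 =>
    le_antisymm (h.w_le p t) (h.wLevel le_rfl hres h1 h2 p).1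
  have hc : ∀ p t, roundEnd G σ (k + 7 * (3 * G.diam + 1) + 7 * T) ≤ t → t ≤ b →
      (σ t p).clock = T ∧ (σ t p).w = 3 * G.diam + 1 := fun p t h1 h2 =>
    ⟨le_antisymm (h.clock_le hD p t) (h.clockLevel le_rfl
      (fun p i h1 h2 => hres p i ((hmono (by omega)).trans h1) h2)
      (fun p t h1 h2 => (hw p t h1 h2).ge) h1 h2 p).1,
      hw p t ((hmono (by omega)).trans h1) h2⟩
  have hreg : ∀ p q, G.Adj p q → ∀ t, roundEnd G σ (k + 7 * (3 * G.diam + 1) + 7 * T + 1) ≤ t →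
      t ≤ b → ((σ t p).reg q).clock = T ∧ ((σ t p).reg q).w = 3 * G.diam + 1 :=
    fun p q hpq t ht htb => h.flow_reg (P := fun r => r.clock = T ∧ r.w = 3 * G.diam + 1) hpq
      (fun i h1 h2 _ => hc p i h1 (by omega)) ht htb
  have himg : ∀ p q, G.Adj p q → ∀ t, roundEnd G σ (k + 7 * (3 * G.diam + 1) + 7 * T + 2) ≤ t →
      t ≤ b → (σ t p).x q = T ∧ (σ t p).y q = 3 * G.diam + 1 :=
    fun p q hpq t ht htb => h.flow_image (P := fun r => r.clock = T ∧ r.w = 3 * G.diam + 1) hpq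
      (fun i h1 h2 => hreg q p hpq.symm i h1 (by omega)) ht htb
  have hreg' : ∀ p q, G.Adj p q → ∀ t,
      roundEnd G σ (k + 7 * (3 * G.diam + 1) + 7 * T + 3) ≤ t → t ≤ b →
      ((σ t p).reg q).x = T ∧ ((σ t p).reg q).y = 3 * G.diam + 1 :=
    fun p q hpq t ht htb => h.flow_reg (P := fun r => r.x = T ∧ r.y = 3 * G.diam + 1) hpq
      (fun i h1 h2 _ => himg p q hpq i h1 (by omega)) ht htb
  have hecho : ∀ p q, G.Adj p q → (σ b p).r q = T ∧ (σ b p).s q = 3 * G.diam + 1 :=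
    fun p q hpq => h.flow_image (P := fun r => r.x = T ∧ r.y = 3 * G.diam + 1) hpq
      (fun i h1 h2 => hreg' q p hpq.symm i h1 h2.le) (le_refl b) le_rfl
  refine ⟨fun p => hc p b (hmono (by omega)) le_rfl, fun p q hpq => ?_⟩
  obtain ⟨h1, h2⟩ := hc p b (hmono (by omega)) le_rfl
  obtain ⟨h1', h2'⟩ := hc q b (hmono (by omega)) le_rfl
  obtain ⟨h3, h4⟩ := hreg p q hpq b (hmono (by omega)) le_rfl
  obtain ⟨h5, h6⟩ := himg p q hpq b (hmono (by omega)) le_rfl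
  obtain ⟨h5', h6'⟩ := himg q p hpq.symm b (hmono (by omega)) le_rfl
  obtain ⟨h7, h8⟩ := hreg' p q hpq b (hmono (by omega)) le_rfl
  obtain ⟨h9, h10⟩ := hecho p q hpq
  refine ⟨?_, by omega, by omega, by omega, by omega⟩
  rw [Reg.ext_iff]
  exact ⟨h3.trans h1.symm, h4.trans h2.symm, h7.trans h5.symm, h8.trans h6.symm⟩

end Liveness

/-! ### Low clocks exclude all later resets -/

section NoReset

variable {V : Type*} {G : SimpleGraph V} {T : ℕ} {σ : ℕ → State V}

/-- The relation of a pair of values of `clock` and `w` to the largest value `m` that the clock has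
had until then: `w` has kept up with `m` above `B`, and once `m` is large the clock does not drop. -/
def KeepsUp (G : SimpleGraph V) (B m c w : ℕ) : Prop :=
  c ≤ m ∧ (B + 3 * G.diam + 1 ≤ m → c = m) ∧ (m ≤ B + w ∨ 3 * G.diam + 1 ≤ w)

/-- `M`, `MR` and `MX` are the largest values that the clocks have had, as of the present, of the
last write to a register, and of the write from which an image comes. -/
structure HighWater (G : SimpleGraph V) (B : ℕ) (σ : State V) (M : V → ℕ) (MR MX : V → V → ℕ) :
    Prop where
  own : ∀ p, KeepsUp G B (M p) (σ p).clock (σ p).w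
  reg : ∀ p q, G.Adj p q → KeepsUp G B (MR p q) ((σ p).reg q).clock ((σ p).reg q).w
  image : ∀ p q, G.Adj p q → KeepsUp G B (MX p q) ((σ p).x q) ((σ p).y q)
  reg_le : ∀ p q, G.Adj p q → MR p q ≤ M p
  image_le : ∀ p q, G.Adj p q → MX p q ≤ MR q p
  climb : ∀ p q, G.Adj p q → M p ≤ B ∨ M p ≤ MX p q + 1

/-- A clock above `T - D` is so high that it and the images it sees equal their marks. `climb` in
both directions, with `MX ≤ MR ≤ M`, puts these marks within one of each other, so there is no gap.
-/
theorem HighWater.not_reset {B : ℕ} {M : V → ℕ} {MR MX : V → V → ℕ} {i : ℕ}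
    (hi : HighWater G B (σ i) M MR MX) (hT : B + 4 * G.diam + 1 ≤ T) (p : V) :
    ¬ ResetAt G T σ p i := by
  rintro ⟨-, h1, h2⟩
  refine not_gap_of_forall (fun q hq => ?_) h2
  obtain ⟨h3, h4, -⟩ := hi.own p
  have h5 := h4 (by omega)
  have h6 := hi.climb p q hq
  obtain ⟨h7, h8, -⟩ := hi.image p q hq
  have h9 := h8 (by omega)
  have h10 := hi.image_le p q hq
  have h11 := hi.reg_le q p hq.symm
  have h12 := hi.climb q p hq.symm
  have h13 := hi.image_le q p hq.symm
  have h14 := hi.reg_le p q hq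
  omega

/-- Three moves matter. Following a neighbour gives `w = y q + 1`, where `y q` has kept up with `MX
p q ≥ M p - 1` if `M p` exceeds `B`. An increment needs `clock ≤ x q ≤ MX p q`. A drop by `S5` needs
`w ≤ 3D`, hence `M p ≤ B + 3D`, where drops are allowed. -/
theorem HighWater.own_succ (h : IsComputation G T σ) {B : ℕ} {M : V → ℕ} {MR MX : V → V → ℕ}
    {i : ℕ} (hi : HighWater G B (σ i) M MR MX) (hT : B + 4 * G.diam + 1 ≤ T) (p : V) :
    KeepsUp G B (max (M p) (σ (i + 1) p).clock) (σ (i + 1) p).clock (σ (i + 1) p).w ∧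
      ∀ q, G.Adj p q → max (M p) (σ (i + 1) p).clock ≤ B ∨
        max (M p) (σ (i + 1) p).clock ≤ MX p q + 1 := by
  have hown := hi.own p
  have hcl := hi.climb p
  have same : (σ (i + 1) p).clock = (σ i p).clock → (σ (i + 1) p).w = (σ i p).w →
      KeepsUp G B (max (M p) (σ (i + 1) p).clock) (σ (i + 1) p).clock (σ (i + 1) p).w ∧
      ∀ q, G.Adj p q → max (M p) (σ (i + 1) p).clock ≤ B ∨
        max (M p) (σ (i + 1) p).clock ≤ MX p q + 1 := by
    intro h1 h2
    rw [h1, h2, max_eq_left hown.1]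
    exact ⟨hown, hcl⟩
  rcases h.event p i with he | ⟨q, hr⟩ | hs | hs | ⟨q, hw⟩
  · exact same (by rw [he]) (by rw [he])
  · exact same hr.next.1 hr.next.2.1
  · rw [hs.next.1, hs.next.2.1, max_eq_left hown.1]
    refine ⟨⟨hown.1, hown.2.1, ?_⟩, hcl⟩
    have hw := h.w_le p i
    have h3 := hown.2.2
    rcases execS2_w_cases G p (σ i p) with ⟨h4, -⟩ | ⟨h4, -⟩ | ⟨q, hq, h5, -, h4⟩
    · omega
    · omega
    · have h6 := (hi.image p q hq).2.2
      have h7 := hcl q hq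
      omega
  · obtain ⟨h1, h2, h3⟩ := hown
    rcases hs.cases with ⟨h4, h5, -, h6, h7, -⟩ | ⟨-, -, h4⟩ | ⟨h4, h5, -, -, h6, h7⟩ |
      ⟨h4, h5, -⟩
    · unfold wBigr at h6
      refine ⟨⟨le_max_right _ _, ?_, ?_⟩, fun q hq => ?_⟩
      · omega
      · omega
      · have h8 := h7 q hq
        have h9 := (hi.image p q hq).1
        have h10 := hcl q hq
        omega
    · exact absurd h4 (hi.not_reset hT p)
    · rw [h4, h5, max_eq_left (by omega)]
      exact ⟨⟨by omega, by omega, h3⟩, hcl⟩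
    · exact same h4 h5
  · exact same hw.next.1 hw.next.2.1

-- The marks travel with the data, being copied at each write and read. Reading can only increase
-- `MX`, so `climb` survives.
open Classical in
theorem HighWater.succ (h : IsComputation G T σ) {B : ℕ} {M : V → ℕ} {MR MX : V → V → ℕ}
    {i : ℕ} (hi : HighWater G B (σ i) M MR MX) (hT : B + 4 * G.diam + 1 ≤ T) :
    HighWater G B (σ (i + 1)) (fun p => max (M p) (σ (i + 1) p).clock)
      (fun p q => if WriteAt G σ p q i then M p else MR p q)
      (fun p q => if ReadAt σ p q i then MR q p else MX p q) where
  own p := (hi.own_succ h hT p).1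
  reg p q hpq := by
    split_ifs with hw
    · rw [hw.next.2.2.2.1]; exact hi.own p
    · rw [h.reg_succ hw]; exact hi.reg p q hpq
  image p q hpq := by
    split_ifs with hr
    · have h1 := hi.reg q p hpq.symm
      rw [← hr.next.2.2.2.1] at h1
      exact h1
    · rw [image_x (h.image_succ hr), image_y (h.image_succ hr)]
      exact hi.image p q hpq
  reg_le p q hpq := by
    have := hi.reg_le p q hpq
    split_ifs <;> omega
  image_le p q hpq := by
    have h1 := hi.image_le p q hpq
    have h2 := hi.reg_le q p hpq.symm
    split_ifs <;> omega
  climb p q hpq := by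
    have h1 := hi.image_le p q hpq
    have h2 := (hi.own_succ h hT p).2 q hpq
    split_ifs <;> omega

/-- If all clocks, registers and images are low enough, then there is no further reset. -/
theorem IsComputation.not_resetAt_of_low (h : IsComputation G T σ) {B s : ℕ}
    (hT : B + 4 * G.diam + 1 ≤ T) (hc : ∀ p, (σ s p).clock ≤ B)
    (hr : ∀ p q, G.Adj p q → ((σ s p).reg q).clock ≤ B)
    (hx : ∀ p q, G.Adj p q → (σ s p).x q ≤ B) {i : ℕ} (hi : s ≤ i) (p : V) :
    ¬ ResetAt G T σ p i := by
  suffices hs : ∃ M MR MX, HighWater G B (σ i) M MR MX by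
    obtain ⟨M, MR, MX, hM⟩ := hs
    exact hM.not_reset hT p
  induction i, hi using Nat.le_induction with
  | base =>
    -- All marks start at `B`, where `KeepsUp` asks nothing of `w` and `climb` holds by its first
    -- alternative.
    have low : ∀ c w, c ≤ B → KeepsUp G B B c w := fun c w hcB =>
      ⟨hcB, fun hcon => by omega, Or.inl (by omega)⟩
    exact ⟨fun _ => B, fun _ _ => B, fun _ _ => B, fun p => low _ _ (hc p),
      fun p q hpq => low _ _ (hr p q hpq), fun p q hpq => low _ _ (hx p q hpq),
      fun _ _ _ => le_rfl, fun _ _ _ => le_rfl, fun _ _ _ => Or.inl le_rfl⟩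
  | succ i hi ih =>
    obtain ⟨M, MR, MX, hM⟩ := ih
    exact ⟨_, _, _, hM.succ h hT⟩

end NoReset

/-! ### The wave of raises that follows a reset -/

section Wave

variable {V : Type*} {G : SimpleGraph V} {T : ℕ} {σ : ℕ → State V}

/-- At index `e`, process `p` raises `w` from `v` to `v + 1`. -/
def RaiseAt (G : SimpleGraph V) (σ : ℕ → State V) (p : V) (v e : ℕ) : Prop :=
  S2At G σ p e ∧ (σ e p).w = v ∧ (σ (e + 1) p).w = v + 1 ∧ wEcho G p (σ e p) ∧
    ∀ q, G.Adj p q → v ≤ (σ e p).y q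

theorem exists_crossing {f : ℕ → ℕ} {v t₁ t₂ : ℕ} (h12 : t₁ ≤ t₂) (h1 : f t₁ ≤ v)
    (h2 : v < f t₂) : ∃ e, t₁ ≤ e ∧ e < t₂ ∧ f e ≤ v ∧ v < f (e + 1) := by
  induction t₂, h12 using Nat.le_induction with
  | base => omega
  | succ t ht ih =>
    by_cases hv : v < f t
    · obtain ⟨e, h3, h4, h5⟩ := ih hv
      exact ⟨e, h3, by omega, h5⟩
    · exact ⟨t, ht, by omega, by omega, h2⟩

/-- Only the echo branch of `S2` increases `w`, and by one at most, so no value is skipped on the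
way up. -/
theorem IsComputation.exists_raiseAt (h : IsComputation G T σ) {p : V} {v t₁ t₂ : ℕ}
    (h12 : t₁ ≤ t₂) (h1 : (σ t₁ p).w ≤ v) (h2 : v < (σ t₂ p).w) :
    ∃ e, t₁ ≤ e ∧ e < t₂ ∧ RaiseAt G σ p v e := by
  obtain ⟨e, h3, h4, h5, h6⟩ := exists_crossing (f := fun t => (σ t p).w) h12 h1 h2
  refine ⟨e, h3, h4, ?_⟩
  rcases h.event p e with he | ⟨q, hr⟩ | hs | hs | ⟨q, hw⟩
  · rw [he] at h6; omega
  · rw [hr.next.2.1] at h6; omega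
  · have h7 := hs.next.2.1
    rcases execS2_w_cases G p (σ e p) with ⟨h8, -⟩ | ⟨h8, h9, h10⟩ | ⟨q, hq, h9, -, h8⟩
    · omega
    · have hv : (σ e p).w = v := by omega
      exact ⟨hs, hv, by omega, h9, fun q hq => hv ▸ h10 q hq⟩
    · omega
  · rcases hs.cases with ⟨-, h7, -⟩ | ⟨-, h7, -⟩ | ⟨-, h7, -⟩ | ⟨-, h7, -⟩ <;> omega
  · rw [hw.next.2.1] at h6; omega

/-- The cycle order forces a whole `S1` between a write and the next `S2`. -/
theorem IsComputation.readAt_between (h : IsComputation G T σ) {p q z : V} {g a : ℕ}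
    (hg : WriteAt G σ p z g) (ha : S2At G σ p a) (hga : g ≤ a) (hq : G.Adj p q) :
    ∃ i, g ≤ i ∧ i < a ∧ ReadAt σ p q i := by
  have key : ∀ t, g ≤ t → (∃ i, g ≤ i ∧ i < t ∧ ReadAt σ p q i) ∨
      (∃ R, (σ t p).pc = PC.write R) ∨ ∃ R, (σ t p).pc = PC.read R ∧ q ∈ R := by
    intro t ht
    induction t, ht using Nat.le_induction with
    | base =>
      obtain ⟨R, hR, -⟩ := hg
      exact Or.inr (Or.inl ⟨R, hR⟩)
    | succ t ht ih =>
      rcases ih with ⟨i, h1, h2, h3⟩ | ⟨R, hR⟩ | ⟨R, hR, hqR⟩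
      · exact Or.inl ⟨i, h1, by omega, h3⟩
      · right
        rcases h.event p t with he | ⟨q', R', hR', -⟩ | hs | hs | ⟨q', hw⟩
        · rw [he]; exact Or.inl ⟨R, hR⟩
        · rw [hR'] at hR; cases hR
        · rw [hs.1] at hR; cases hR
        · rw [hs.1] at hR; cases hR
        · rw [(hw.pc_next hR).2]
          by_cases hE : R \ {q'} = ∅
          · have hN : G.neighborSet p ≠ ∅ := Set.nonempty_iff_ne_empty.1 ⟨q, hq⟩
            rw [hE, writePC_empty, startPC, readPC_of_ne hN]
            exact Or.inr ⟨_, rfl, hq⟩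
          · rw [writePC_of_ne G p hE]; exact Or.inl ⟨_, rfl⟩
      · rcases h.event p t with he | ⟨q', hr⟩ | hs | hs | ⟨q', R', hR', -⟩
        · rw [he]; exact Or.inr (Or.inr ⟨R, hR, hqR⟩)
        · by_cases hqq : q = q'
          · subst hqq; exact Or.inl ⟨t, ht, by omega, hr⟩
          · right; right
            have hmem : q ∈ R \ {q'} := ⟨hqR, hqq⟩
            have hE : R \ {q'} ≠ ∅ := Set.nonempty_iff_ne_empty.1 ⟨q, hmem⟩
            rw [(hr.pc_next hR).2, readPC_of_ne hE]
            exact ⟨_, rfl, hmem⟩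
        · rw [hs.1] at hR; cases hR
        · rw [hs.1] at hR; cases hR
        · rw [hR'] at hR; cases hR
  rcases key a hga with h1 | ⟨R, h1⟩ | ⟨R, h1, -⟩
  · exact h1
  · rw [ha.1] at h1; cases h1
  · rw [ha.1] at h1; cases h1

/-- While `w ≤ 3D`, the clock does not rise above `3D`. -/
theorem IsComputation.clock_le_of_w_le (h : IsComputation G T σ) {p : V} {a b : ℕ}
    (hw : ∀ t, a ≤ t → t < b → (σ t p).w ≤ 3 * G.diam) (hc : (σ a p).clock ≤ 3 * G.diam)
    {t : ℕ} (ht : a ≤ t) (htb : t ≤ b) : (σ t p).clock ≤ 3 * G.diam := by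
  refine persists (P := fun t => (σ t p).clock ≤ 3 * G.diam) (fun t h1 h2 h3 => ?_) le_rfl hc
    ht htb
  rcases h.event p t with he | ⟨q, hr⟩ | hs | hs | ⟨q, hw⟩
  · rw [he]; exact h3
  · rw [hr.next.1]; exact h3
  · rw [hs.next.1]; exact h3
  · have h4 := hw t h1 h2
    rcases hs.cases with ⟨h5, -, -, h6, -⟩ | ⟨h5, -⟩ | h5 | ⟨h5, -⟩
    · unfold wBigr at h6
      omega
    · omega
    · omega
    · omega
  · rw [hw.next.1]; exact h3

theorem exists_walk_length_le_diam (hG : G.Connected) (hD : G.diam ≠ 0) (p q : V) :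
    ∃ W : G.Walk p q, W.length ≤ G.diam := by
  obtain ⟨W, hW⟩ := hG.exists_walk_length_eq_dist p q
  exact ⟨W, hW ▸ SimpleGraph.dist_le_diam (SimpleGraph.ediam_ne_top_of_diam_ne_zero hD)⟩

variable [Finite V]

theorem IsComputation.source_fields (h : IsComputation G T σ) {p q : V} (hpq : G.Adj p q)
    {k e : ℕ} (he : roundEnd G σ (k + 2) ≤ e) :
    roundEnd G σ k ≤ source G σ p q e ∧ source G σ p q e < e ∧
      WriteAt G σ q p (source G σ p q e) ∧
      (σ e p).x q = (σ (source G σ p q e) q).clock ∧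
      (σ e p).y q = (σ (source G σ p q e) q).w ∧
      (σ e p).s q = (σ (source G σ p q e) q).y p := by
  obtain ⟨h1, h2, h3, h4, h5⟩ := h.source_spec hpq he
  exact ⟨h1, h2.trans h3, h4, congrArg Reg.clock h5, congrArg Reg.w h5, congrArg Reg.y h5⟩

/-- After the write whose echo lets `p` raise `w` from `v`, `w` does not exceed `v + 2` until the
raise. -/
theorem IsComputation.w_le_add_two (h : IsComputation G T σ) {p q : V} (hpq : G.Adj p q)
    {v e t : ℕ} (he : roundEnd G σ 8 ≤ e) (hraise : RaiseAt G σ p v e)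
    (ht : source G σ q p (source G σ p q e) ≤ t) (hte : t ≤ e) : (σ t p).w ≤ v + 2 := by
  by_contra! hcon
  have : Nonempty V := ⟨p⟩
  have hmono := h.roundEnd_strictMono.monotone
  have echo : ∀ {e' v'}, roundEnd G σ 4 ≤ e' → RaiseAt G σ p v' e' →
      (σ (source G σ p q e') q).y p = v' ∧
      (σ (source G σ q p (source G σ p q e')) p).w = v' ∧ roundEnd G σ 2 ≤ source G σ p q e' := by
    intro e' v' he' hr
    obtain ⟨h1, -, -, -, -, h2⟩ := h.source_fields hpq (k := 2) he'
    obtain ⟨-, -, -, -, h3, -⟩ := h.source_fields hpq.symm (k := 0) h1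
    have h4 := hr.2.2.2.1 q hpq
    have h5 := hr.2.1
    exact ⟨by omega, by omega, h1⟩
  obtain ⟨hf, -⟩ := h.source_fields hpq (k := 6) he
  obtain ⟨hg4, -, hgw, -, -, -⟩ := h.source_fields hpq.symm (k := 4) hf
  obtain ⟨hfy, hgv, -⟩ := echo ((hmono (by omega)).trans he) hraise
  -- `g` is the write of `p`, and `f` the reply of `q`, behind the echo used at `e`; in particular
  -- `w` is `v` at `g`.
  set f := source G σ p q e
  set g := source G σ q p f
  -- Exceeding `v + 2` takes three raises `a < b < c` from `v`, `v + 1`, `v + 2`, whose echoes are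
  -- all distinct.
  obtain ⟨a, ha1, hat, ha⟩ := h.exists_raiseAt ht hgv.le (by omega)
  obtain ⟨b, hb1, hbt, hb⟩ := h.exists_raiseAt (v := v + 1) (Nat.succ_le_of_lt hat) ha.2.2.1.le
    (by omega)
  obtain ⟨c, hc1, hct, hc⟩ := h.exists_raiseAt (v := v + 2) (Nat.succ_le_of_lt hbt) hb.2.2.1.le
    (by omega)
  obtain ⟨hfa, hga, -⟩ := echo (hg4.trans ha1) ha
  obtain ⟨hfb, hgb, -⟩ := echo (hg4.trans (by omega)) hb
  obtain ⟨hfc, hgc, hc2⟩ := echo (hg4.trans (by omega)) hc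
  have hab : source G σ p q a ≤ source G σ p q b := source_mono p q (by omega)
  have hbc : source G σ p q b ≤ source G σ p q c := source_mono p q (by omega)
  have hcf : source G σ p q c ≤ f := source_mono p q (by omega)
  -- The value `v + 2` echoed at `c` was read by `q` no later than `g`, since a later read feeding a
  -- reply up to `f` would return the value `v` written at `g`.
  have h1 : lastBefore (ReadAt σ q p) (source G σ p q c) ≤ g := by
    by_contra! hlt
    have h1 : g ≤ source G σ q p (source G σ p q c) := le_lastBefore hlt hgw
    have h2 : source G σ q p (source G σ p q c) ≤ g := source_mono q p hcf
    rw [le_antisymm h2 h1] at hgc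
    omega
  -- The reply carrying `v + 1` precedes that read, or both replies would rest on the same read.
  have h2 : source G σ p q b ≤ lastBefore (ReadAt σ q p) (source G σ p q c) := by
    by_contra! hlt
    obtain ⟨-, -, hrd, -⟩ := h.lastRead_spec hpq.symm (k := 1) hc2
    have h1 := le_lastBefore hlt hrd
    have h2 := lastBefore_mono (ReadAt σ q p) hbc
    rw [source, le_antisymm h2 h1] at hgb
    rw [source] at hgc
    omega
  -- So the reply used at `b` was available by `g`. As `p` reads `q` between `g` and `a`, the raise
  -- at `a` already uses it, although `a` needs the echo `v`.
  obtain ⟨i, hi1, hi2, hi⟩ := h.readAt_between hgw ha.1 ha1 hpq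
  have hig : i ≠ g := by
    rintro hig
    obtain ⟨R, hR, -⟩ := hgw
    obtain ⟨R', hR', -⟩ := hi
    rw [hig, hR] at hR'
    cases hR'
  have h3 := le_lastBefore hi2 hi
  obtain ⟨-, -, hwb, -⟩ := h.source_fields hpq (k := 2) (hg4.trans (show g ≤ b by omega))
  have h4 : source G σ p q b ≤ source G σ p q a := le_lastBefore (by omega) hwb
  rw [le_antisymm hab h4] at hfa
  omega

/-- The wave that starts at a process with `w = 0` has reached `p`, at distance at most `m`, and
left it before `s`: since the wave reached `p` its clock has been low. -/
def WavePassed (G : SimpleGraph V) (σ : ℕ → State V) (s k m : ℕ) (p : V) : Prop :=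
  ∃ e, RaiseAt G σ p m e ∧ e < s ∧ roundEnd G σ (k + 4 + 4 * (G.diam - m)) ≤ e ∧
    (∃ t, e < t ∧ t ≤ s ∧ 2 * G.diam + 1 ≤ (σ t p).w + m) ∧
    ∀ q, G.Adj p q → ∀ t, source G σ q p (source G σ p q e) ≤ t → t ≤ s →
      (σ t p).clock ≤ 3 * G.diam + m

/-- At the echoed write grounding gives `clock ≤ w ≤ 3D`; from there to the raise `w` stays at most
`v + 2 ≤ 3D`, which caps the clock. -/
theorem IsComputation.clock_le_until_raise (h : IsComputation G T σ) {k : ℕ} (hk : 4 ≤ k)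
    (hall : ∀ t, roundEnd G σ k ≤ t → AllLevel G (3 * G.diam + 1) (σ t)) {p q : V}
    (hpq : G.Adj p q) {v e : ℕ} (hv : v + 2 ≤ 3 * G.diam) (he : roundEnd G σ (k + 4) ≤ e)
    (hraise : RaiseAt G σ p v e) {t : ℕ} (ht : source G σ q p (source G σ p q e) ≤ t)
    (hte : t ≤ e) : (σ t p).clock ≤ 3 * G.diam := by
  have : Nonempty V := ⟨p⟩
  have hmono := h.roundEnd_strictMono.monotone
  have hw : ∀ t, source G σ q p (source G σ p q e) ≤ t → t ≤ e → (σ t p).w ≤ 3 * G.diam :=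
    fun t h1 h2 => (h.w_le_add_two hpq ((hmono (by omega)).trans he) hraise h1 h2).trans hv
  obtain ⟨h1, -, -⟩ := h.source_fields hpq (k := k + 2) he
  obtain ⟨h2, -, h3, -⟩ := h.source_fields hpq.symm h1
  refine h.clock_le_of_w_le (fun t h1 h2 => hw t h1 h2.le) ?_ ht hte
  have h4 := (ownLevel_iff h3.pc_ne).1 (hall _ h2 p).1
  have h5 := hw _ le_rfl (ht.trans hte)
  unfold Level at h4
  omega

/-- When `q` echoes `m`, its `w` is at most `m + 1`; before `p` can rise above `2D - m`, the `w` of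
`q` must be at least `2D - m`. As `m + 1 ≤ D`, the latter is larger, so `q` raises from `m + 1` in
between. The threshold thus loses one per hop and `2D` suffices. -/
theorem WavePassed.step (h : IsComputation G T σ) {k : ℕ} (hk : 4 ≤ k)
    (hall : ∀ t, roundEnd G σ k ≤ t → AllLevel G (3 * G.diam + 1) (σ t)) {s m : ℕ} {p q : V}
    (hpq : G.Adj p q) (hm : m + 1 ≤ G.diam) (hp : WavePassed G σ s k m p) :
    WavePassed G σ s k (m + 1) q := by
  have : Nonempty V := ⟨p⟩
  have hmono := h.roundEnd_strictMono.monotone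
  obtain ⟨e, hraise, hes, hek, ⟨t, het, hts, htw⟩, hclock⟩ := hp
  obtain ⟨hρk, hρe, hρw, -, -, hρs⟩ := h.source_fields hpq
    (k := k + 4 + 4 * (G.diam - (m + 1))) ((hmono (by omega)).trans hek)
  have hρ : (σ (source G σ p q e) q).w ≤ m + 1 := by
    obtain ⟨R, hR, -⟩ := hρw
    have h1 := h.w_le_y_add_one hpq.symm ((hmono (by omega)).trans hρk) (Or.inr ⟨R, hR⟩)
    have h2 := hraise.2.2.2.1 q hpq
    have h3 := hraise.2.1
    omega
  obtain ⟨e₂, he₂, he₂t, hraise₂⟩ := h.exists_raiseAt het.le (v := 2 * G.diam - m)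
    (hraise.2.1.trans_le (by omega)) (by omega)
  obtain ⟨-, hf₂, -, -, hfy, -⟩ := h.source_fields hpq (k := 0) (e := e₂)
    ((hmono (by omega)).trans (hek.trans he₂))
  have hfw := hraise₂.2.2.2.2 q hpq
  have hρf : source G σ p q e ≤ source G σ p q e₂ := source_mono p q he₂
  obtain ⟨e', he', he'f, hraise'⟩ := h.exists_raiseAt hρf hρ (by omega)
  refine ⟨e', hraise', by omega, hρk.trans he', ⟨source G σ p q e₂, he'f, by omega, by omega⟩,
    fun u hu t ht hts => ?_⟩
  have hlow : ∀ t, source G σ u q (source G σ q u e') ≤ t → t ≤ e' →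
      (σ t q).clock ≤ 3 * G.diam := fun t ht hte =>
    h.clock_le_until_raise hk hall hu (by omega) ((hmono (by omega)).trans (hρk.trans he'))
      hraise' ht hte
  rcases le_total t e' with hte | hte
  · exact (hlow t ht hte).trans (by omega)
  obtain ⟨hs0, hs1, -⟩ := h.source_fields hu (k := 2) (e := e')
    ((hmono (by omega)).trans (hρk.trans he'))
  obtain ⟨-, hs2, -⟩ := h.source_fields hu.symm (k := 0) hs0
  refine persists (P := fun t => (σ t q).clock ≤ 3 * G.diam + (m + 1)) (a := e') (b := s)
    (fun t h1 h2 h3 => ?_) le_rfl ((hlow e' (by omega) le_rfl).trans (by omega)) hte hts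
  rcases h.event q t with he | ⟨q', hr⟩ | hs | hs | ⟨q', hw⟩
  · rw [he]; exact h3
  · rw [hr.next.1]; exact h3
  · rw [hs.next.1]; exact h3
  · rcases hs.cases with ⟨h5, -, -, -, h6, -⟩ | ⟨h5, -⟩ | h5 | ⟨h5, -⟩
    -- An increment needs `clock ≤ x p`, and this image was written after the bound `3D + m` on the
    -- clock of `p` took effect; hence one more unit per hop.
    · have h7 := h6 p hpq.symm
      obtain ⟨-, h8, -, h9, -⟩ := h.source_fields hpq.symm (k := 0) (e := t)
        ((hmono (by omega)).trans ((hρk.trans he').trans h1))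
      have h10 := hclock q hpq (source G σ q p t) (source_mono q p (he'.trans h1)) (by omega)
      omega
    · omega
    · omega
    · omega
  · rw [hw.next.1]; exact h3

theorem WavePassed.walk (h : IsComputation G T σ) {k : ℕ} (hk : 4 ≤ k)
    (hall : ∀ t, roundEnd G σ k ≤ t → AllLevel G (3 * G.diam + 1) (σ t)) {s : ℕ} {p q : V}
    (W : G.Walk p q) {m : ℕ} (hm : m + W.length ≤ G.diam) (hp : WavePassed G σ s k m p) :
    WavePassed G σ s k (m + W.length) q := by
  induction W generalizing m with
  | nil => exact hp
  | cons hadj W ih =>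
    rw [SimpleGraph.Walk.length_cons] at hm ⊢
    have := ih (m := m + 1) (by omega) (hp.step h hk hall hadj (by omega))
    rwa [show m + (W.length + 1) = m + 1 + W.length by omega]

/-- All clocks, and all their copies in registers and images, are at most `B`. -/
def ClocksLow (G : SimpleGraph V) (B : ℕ) (σ : State V) : Prop :=
  ∀ p, (σ p).clock ≤ B ∧ ∀ q, G.Adj p q → ((σ p).reg q).clock ≤ B ∧ (σ p).x q ≤ B

/-- The wave reaches each process along a walk of length at most `D`, so the bounds `3D + m` are at
most `4D`. They begin at the echoed writes, early enough to cover the registers and images present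
at `s`. -/
theorem IsComputation.clocksLow_of_wave (h : IsComputation G T σ) (hG : G.Connected)
    (hD : G.diam ≠ 0) {k : ℕ} (hk : 4 ≤ k)
    (hall : ∀ t, roundEnd G σ k ≤ t → AllLevel G (3 * G.diam + 1) (σ t)) {p : V} {t₀ s : ℕ}
    (ht₀ : roundEnd G σ (k + 4 + 4 * G.diam) ≤ t₀) (h0 : (σ t₀ p).w = 0) (hts : t₀ ≤ s)
    (hlow : ∀ t, t₀ ≤ t → t < s → (σ t p).w ≤ 2 * G.diam)
    (hhigh : 2 * G.diam < (σ s p).w) : ClocksLow G (4 * G.diam) (σ s) := by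
  have : Nonempty V := ⟨p⟩
  have hmono := h.roundEnd_strictMono.monotone
  obtain ⟨e, hte, hes, hraise⟩ := h.exists_raiseAt hts h0.le (by omega)
  have hek : roundEnd G σ (k + 4) ≤ e := (hmono (by omega)).trans (ht₀.trans hte)
  have hpassed : WavePassed G σ s k 0 p := by
    refine ⟨e, hraise, hes, ht₀.trans hte, ⟨s, hes, le_rfl, hhigh⟩, fun q hq t ht hts => ?_⟩
    have hearly : ∀ t, source G σ q p (source G σ p q e) ≤ t → t ≤ e →
        (σ t p).clock ≤ 3 * G.diam := fun t ht hte =>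
      h.clock_le_until_raise hk hall hq (by omega) hek hraise ht hte
    rcases le_total t e with hte' | hte'
    · exact hearly t ht hte'
    · have hs1 := h.source_fields hq (k := k + 2) (e := e) hek
      have hs2 := h.source_fields hq.symm (k := k) (e := source G σ p q e) hs1.1
      exact h.clock_le_of_w_le (a := e) (b := s)
        (fun t h1 h2 => (hlow t (by omega) h2).trans (by omega))
        (hearly e (hs2.2.1.le.trans hs1.2.1.le) le_rfl) hte' hts
  have hfront : ∀ q, ∃ m, m ≤ G.diam ∧ WavePassed G σ s k m q := by
    intro q
    obtain ⟨W, hW⟩ := exists_walk_length_le_diam hG hD p q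
    exact ⟨0 + W.length, by omega, hpassed.walk h hk hall W (by omega)⟩
  have hsk : roundEnd G σ 2 ≤ s := (hmono (by omega)).trans (hek.trans hes.le)
  intro q
  obtain ⟨m, hm, e, he1, he2, he3, -, he4⟩ := hfront q
  have hek' : roundEnd G σ (k + 4) ≤ e := (hmono (by omega)).trans he3
  refine ⟨?_, fun u hu => ⟨?_, ?_⟩⟩
  · have hne := SimpleGraph.nontrivial_of_diam_ne_zero hD
    obtain ⟨u, hu⟩ := hG.preconnected.exists_adj_of_nontrivial q
    obtain ⟨h1, h2, -⟩ := h.source_fields hu (k := k + 2) hek'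
    obtain ⟨h3, h4, -⟩ := h.source_fields hu.symm h1
    exact (he4 u hu s (by omega) le_rfl).trans (by omega)
  · obtain ⟨h1, h2, h3, h4⟩ := h.lastWrite_spec hu (k := 1) hsk
    rw [h4]
    refine (he4 u hu _ (lastBefore_mono _ ?_) h2.le).trans (by omega)
    obtain ⟨h5, h6, -⟩ := h.source_fields hu (k := k + 2) hek'
    obtain ⟨-, h7, -⟩ := h.lastRead_spec hu.symm (k := k + 1) h5
    omega
  · obtain ⟨m', hm', e', he1', he2', he3', -, he4'⟩ := hfront u
    have hek'' : roundEnd G σ (k + 4) ≤ e' := (hmono (by omega)).trans he3'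
    obtain ⟨-, h5, -, h6, -⟩ := h.source_fields hu (k := 0) (e := s) hsk
    obtain ⟨-, h7, -⟩ := h.source_fields hu.symm (k := k + 2) hek''
    rw [h6]
    exact (he4' q hu.symm _ (source_mono q u (by omega)) h5.le).trans (by omega)

end Wave

/-! ### Invariance and the count of rounds -/

section Convergence

variable {V : Type*} {G : SimpleGraph V} {T : ℕ} {σ : ℕ → State V}

/-- Every assignment reproduces the present value: copies already agree, `S2` yields `1 + 3D`, and
without a gap or a clock below `T` no guard holds. -/
theorem TimerFinal.step {p : V} {σ σ' : State V} (hT : TimerFinal G T σ)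
    (hs : Step G T p σ σ') : TimerFinal G T σ' := by
  obtain ⟨h1, h2⟩ := hT
  obtain ⟨hstep, hother⟩ := hs
  have himg : ∀ q, G.Adj p q → (σ q).reg p = (σ p).image q := by
    intro q hq
    obtain ⟨-, h3, h4, h5, h6⟩ := h2 p q hq
    rw [(h2 q p hq.symm).1, Config.image, h3, h4, h5, h6]
  have hout : ∀ q, G.Adj p q → (σ p).reg q = (σ p).output q := fun q hq => (h2 p q hq).1
  have hgap : ¬ gap G p (σ p) := not_gap_of_forall fun q hq => by
    have h3 := (h2 p q hq).2.1
    have h4 := (h1 p).1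
    have h5 := (h1 q).1
    omega
  suffices hp : (σ' p).clock = (σ p).clock ∧ (σ' p).w = (σ p).w ∧ ∀ q, G.Adj p q →
      (σ' p).image q = (σ p).image q ∧ (σ' p).reg q = (σ p).reg q by
    have hall : ∀ a, (σ' a).clock = (σ a).clock ∧ (σ' a).w = (σ a).w ∧ ∀ b, G.Adj a b →
        (σ' a).image b = (σ a).image b ∧ (σ' a).reg b = (σ a).reg b := by
      intro a
      by_cases ha : a = p
      · subst ha; exact hp
      · rw [hother a ha]; exact ⟨rfl, rfl, fun _ _ => ⟨rfl, rfl⟩⟩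
    refine ⟨fun a => ?_, fun a b hab => ?_⟩
    · rw [(hall a).1, (hall a).2.1]; exact h1 a
    · obtain ⟨h3, h4, h5⟩ := hall a
      obtain ⟨h6, h7, h8⟩ := hall b
      obtain ⟨h9, h10⟩ := h5 b hab
      have h11 := (h8 a hab.symm).1
      simp only [Config.image, Reg.mk.injEq] at h9 h11
      rw [h10, h3, h4, h6, h7, h9.1, h9.2.1, h9.2.2.1, h9.2.2.2, h11.1, h11.2.1]
      exact h2 a b hab
  generalize σ' p = c at hstep
  cases hstep with
  | read R q hpc hq =>
    refine ⟨rfl, rfl, fun q' hq' => ⟨?_, rfl⟩⟩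
    by_cases hqq : q' = q
    · subst hqq
      rw [← himg q' hq']
      simp [doRead, Config.image]
    · simp [doRead, Config.image, hqq]
  | s2 hpc =>
    have hw : (execS2 G p (σ p)).w = (σ p).w := by
      have h3 := (h1 p).2
      rcases execS2_w_cases G p (σ p) with ⟨h4, -⟩ | ⟨h4, -⟩ | ⟨q, hq, h5, -⟩
      · exact h4
      · omega
      · have h6 := (h2 p q hq).2.2.1
        have h7 := (h1 q).2
        omega
    rw [execS2_eq, hw]
    exact ⟨rfl, rfl, fun _ _ => ⟨rfl, rfl⟩⟩
  | s36 hpc =>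
    rcases execS36_cases G T p (σ p) with ⟨-, -, -, -, ⟨h3, -⟩ | ⟨h3, -⟩⟩ | ⟨-, -, h3⟩ |
      ⟨-, -, h3, -⟩ | ⟨h3, -⟩
    · have := (h1 p).1
      omega
    · exact absurd h3 hgap
    · exact absurd h3 hgap
    · exact absurd h3 hgap
    · rw [h3]; exact ⟨rfl, rfl, fun _ _ => ⟨rfl, rfl⟩⟩
  | write R q hpc hq =>
    refine ⟨rfl, rfl, fun q' hq' => ⟨rfl, ?_⟩⟩
    by_cases hqq : q' = q
    · subst hqq
      rw [hout q' hq']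
      simp [doWrite, Config.output]
    · simp [doWrite, hqq]

theorem ClocksLow.mono {B B' : ℕ} (hB : B ≤ B') {σ : State V} (h : ClocksLow G B σ) :
    ClocksLow G B' σ := fun p => ⟨(h p).1.trans hB, fun q hq =>
  ⟨((h p).2 q hq).1.trans hB, ((h p).2 q hq).2.trans hB⟩⟩

variable [Finite V]

/-- Three rounds: into the register, into the image, and through an `S2`, which leaves `w ≤ y p +
1`. -/
theorem IsComputation.w_le_succ_of_adj (h : IsComputation G T σ) {p q : V} (hpq : G.Adj p q)
    {k b v : ℕ} (hv : ∀ t, roundEnd G σ k ≤ t → t ≤ b → (σ t p).w ≤ v) {t : ℕ}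
    (ht : roundEnd G σ (k + 3) ≤ t) (htb : t ≤ b) : (σ t q).w ≤ v + 1 := by
  have hy : ∀ t, roundEnd G σ (k + 2) ≤ t → t ≤ b → (σ t q).y p ≤ v := fun t h1 h2 =>
    h.flow_image (P := fun r => r.w ≤ v) hpq.symm (k := k + 1) (fun i h1 h2 =>
      h.flow_reg (P := fun r => r.w ≤ v) hpq (k := k) (b := b)
        (fun i h1 h2 _ => hv i h1 h2.le) h1 h2.le) h1 h2
  have hs2 : ∀ i, roundEnd G σ (k + 2) ≤ i → i < b → S2At G σ q i → (σ (i + 1) q).w ≤ v + 1 := by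
    intro i h1 h2 hs
    have h3 := execS2_w_le_y (c := σ i q) hpq.symm
    have h4 := hy i h1 h2.le
    rw [hs.next.2.1]
    omega
  obtain ⟨i, h1, h2, h3⟩ := h.exists_s2At q (k + 2)
  have h2' : i < roundEnd G σ (k + 3) := h2
  refine persists (P := fun t => (σ t q).w ≤ v + 1) (a := i + 1) (b := b) (fun t h4 h5 h6 => ?_)
    le_rfl (hs2 i h1 (by omega) h3) (by omega) htb
  rcases h.event q t with he | ⟨q', hr⟩ | hs | hs | ⟨q', hw⟩
  · rw [he]; exact h6
  · rw [hr.next.2.1]; exact h6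
  · exact hs2 t (by omega) h5 hs
  · rcases hs.cases with ⟨-, h7, -⟩ | ⟨-, h7, -⟩ | ⟨-, h7, -⟩ | ⟨-, h7, -⟩ <;> omega
  · rw [hw.next.2.1]; exact h6

theorem IsComputation.w_le_add_length (h : IsComputation G T σ) {p q : V} (W : G.Walk p q)
    {k b v : ℕ} (hv : ∀ t, roundEnd G σ k ≤ t → t ≤ b → (σ t p).w ≤ v) {t : ℕ}
    (ht : roundEnd G σ (k + 3 * W.length) ≤ t) (htb : t ≤ b) :
    (σ t q).w ≤ v + W.length := by
  induction W generalizing k v with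
  | nil => exact hv t ht htb
  | cons hadj W ih =>
    rw [SimpleGraph.Walk.length_cons] at ht ⊢
    have := ih (k := k + 3) (v := v + 1) (fun t h1 h2 => h.w_le_succ_of_adj hadj hv h1 h2)
      (by rwa [show k + 3 + 3 * W.length = k + 3 * (W.length + 1) by ring])
    omega

theorem IsComputation.clocksLow_of_w_le (h : IsComputation G T σ) (hG : G.Connected)
    (hD : G.diam ≠ 0) {k : ℕ}
    (hall : ∀ t, roundEnd G σ k ≤ t → AllLevel G (3 * G.diam + 1) (σ t)) {p : V}
    (hlow : ∀ t, roundEnd G σ k ≤ t → t ≤ roundEnd G σ (k + 3 * G.diam + 3) →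
      (σ t p).w ≤ 2 * G.diam) :
    ClocksLow G (3 * G.diam) (σ (roundEnd G σ (k + 3 * G.diam + 3))) := by
  have : Nonempty V := ⟨p⟩
  have hmono := h.roundEnd_strictMono.monotone
  set b := roundEnd G σ (k + 3 * G.diam + 3)
  have hw : ∀ q t, roundEnd G σ (k + 3 * G.diam) ≤ t → t ≤ b → (σ t q).w ≤ 3 * G.diam := by
    intro q t h1 h2
    obtain ⟨W, hW⟩ := exists_walk_length_le_diam hG hD p q
    have := h.w_le_add_length W hlow ((hmono (by omega)).trans h1) h2
    omega
  have hc : ∀ q t, roundEnd G σ (k + 3 * G.diam + 1) ≤ t → t ≤ b →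
      (σ t q).clock ≤ 3 * G.diam := by
    intro q t h1 h2
    -- Just before an `S2` the pending clause of `OwnLevel` is void, so grounding gives `clock ≤ w`.
    obtain ⟨i, h3, h4, h5⟩ := h.exists_s2At q (k + 3 * G.diam)
    refine h.clock_le_of_w_le (a := i) (b := b)
      (fun t h6 h7 => hw q t (h3.trans h6) h7.le) ?_ (by omega) h2
    have h6 := (ownLevel_iff (by rw [h5.1]; exact nofun)).1
      (hall i ((hmono (by omega)).trans h3) q).1
    have h7 := hw q i h3 (by omega)
    unfold Level at h6
    omega
  have hr : ∀ q u, G.Adj q u → ∀ t, roundEnd G σ (k + 3 * G.diam + 2) ≤ t → t ≤ b →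
      ((σ t q).reg u).clock ≤ 3 * G.diam := fun q u hu t h1 h2 =>
    h.flow_reg (P := fun r => r.clock ≤ 3 * G.diam) hu
      (fun i h1 h2 _ => hc q i h1 (by omega)) h1 h2
  exact fun q => ⟨hc q b (hmono (by omega)) le_rfl, fun u hu =>
    ⟨hr q u hu b (hmono (by omega)) le_rfl,
      h.flow_image (P := fun r => r.clock ≤ 3 * G.diam) hu
        (fun i h1 h2 => hr u q hu.symm i h1 h2.le) (le_refl b) le_rfl⟩⟩

theorem no_adj_of_diam_eq_zero [Nonempty V] (hG : G.Connected) (hD : G.diam = 0) (p q : V) :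
    ¬ G.Adj p q := by
  intro hpq
  rcases SimpleGraph.diam_eq_zero.1 hD with h | h
  · exact SimpleGraph.connected_iff_ediam_ne_top.1 hG h
  · exact hpq.ne (Subsingleton.elim p q)

theorem IsComputation.exists_timerFinal (h : IsComputation G T σ) (hG : G.Connected)
    (hT : 11 * G.diam ≤ T) : ∃ t, t ≤ roundEnd G σ (36 * (T + 1)) ∧ TimerFinal G T (σ t) := by
  have : Nonempty V := hG.nonempty
  have hmono := h.roundEnd_strictMono.monotone
  have hno := no_adj_of_diam_eq_zero hG
  rcases Nat.eq_zero_or_pos G.diam with hD | hD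
  · refine ⟨_, hmono ?_, h.timerFinal_of_noReset (k := 0) hno ?_⟩
    · omega
    · rintro p i - - ⟨-, -, q, hq, -⟩
      exact hno hD p q hq
  -- From `k₀` on everything is grounded; `k₁` adds the past that the wave argument looks back on; a
  -- stretch from `k₁` to `k₂` without resets would suffice.
  set k₀ := 7 * (3 * G.diam + 1) with hk₀
  set k₁ := k₀ + 4 + 4 * G.diam with hk₁
  set k₂ := k₁ + 7 * (3 * G.diam + 1) + 7 * T + 4 with hk₂
  have hall : ∀ t, roundEnd G σ k₀ ≤ t → AllLevel G (3 * G.diam + 1) (σ t) := fun t ht =>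
    h.allLevel le_rfl ht
  by_cases hres : ∀ p i, roundEnd G σ k₁ ≤ i → i < roundEnd G σ k₂ → ¬ ResetAt G T σ p i
  · exact ⟨_, hmono (by omega), h.timerFinal_of_noReset hno hres⟩
  push Not at hres
  obtain ⟨p, i, hi1, hi2, hi3⟩ := hres
  have h0 := hi3.w_next
  have hlow : ∃ s, s ≤ roundEnd G σ (k₂ + 3 * G.diam + 3) ∧ ClocksLow G (4 * G.diam) (σ s) := by
    -- The first passage of `w` above `2D` ends the wave. If there is none in time, `w` is small for
    -- long enough after `k₂`.
    by_cases hex : ∃ s, i + 1 ≤ s ∧ 2 * G.diam < (σ s p).w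
    · classical
      obtain ⟨h1, h2⟩ := Nat.find_spec hex
      by_cases hle : Nat.find hex ≤ roundEnd G σ (k₂ + 3 * G.diam + 3)
      · refine ⟨_, hle, h.clocksLow_of_wave hG hD.ne' (by omega) hall (hi1.trans (by omega)) h0 h1
          (fun t h3 h4 => ?_) h2⟩
        have := Nat.find_min hex h4
        omega
      · refine ⟨_, le_rfl, (h.clocksLow_of_w_le hG hD.ne' (p := p) (fun t ht => hall t
          ((hmono (by omega)).trans ht)) (fun t h3 h4 => ?_)).mono (by omega)⟩
        have := Nat.find_min hex (m := t) (by omega)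
        omega
    · push Not at hex
      exact ⟨_, le_rfl, (h.clocksLow_of_w_le hG hD.ne' (p := p) (fun t ht => hall t
        ((hmono (by omega)).trans ht)) (fun t h3 h4 => hex t (by omega))).mono (by omega)⟩
  obtain ⟨s, hs, hlow⟩ := hlow
  -- `B = 4D` needs `8D + 1 ≤ T`, which holds as `D` is positive and `11D ≤ T`.
  refine ⟨_, hmono ?_, h.timerFinal_of_noReset (k := k₂ + 3 * G.diam + 3) hno
    fun q j hj _ => h.not_resetAt_of_low (B := 4 * G.diam) (by omega) (fun q => (hlow q).1)
      (fun q u hu => ((hlow q).2 u hu).1) (fun q u hu => ((hlow q).2 u hu).2) (hs.trans hj) q⟩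
  -- The total is `70D + 14T + 36` rounds, and `11D ≤ T`.
  omega

end Convergence

end RepairTimer

open RepairTimer in
theorem theorem1 :
    (∀ (V : Type) [Fintype V] (G : SimpleGraph V) (T : ℕ), G.Connected → 11 * G.diam ≤ T →
      FinalInvariant G T) ∧
    (∃ K : ℕ, ∀ (V : Type) [Fintype V] (G : SimpleGraph V) (T : ℕ), G.Connected →
      11 * G.diam ≤ T → FinalWithin G T (K * (T + 1))) ∧
    (∀ c : ℕ, ∃ K : ℕ, ∀ (V : Type) [Fintype V] [Nontrivial V] (G : SimpleGraph V) (T : ℕ),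
      G.Connected → 11 * G.diam ≤ T → T ≤ c * G.diam →
      FinalWithin G T (K * G.diam)) := by
  refine ⟨fun V _ G T _ _ p σ σ' hσ hs => hσ.step hs,
    ⟨36, fun V _ G T hG hT σ h => h.exists_timerFinal hG hT⟩,
    fun c => ⟨36 * (c + 1), fun V _ _ G T hG hT hc σ h => ?_⟩⟩
  obtain ⟨t, ht, hfinal⟩ := h.exists_timerFinal hG hT
  have hD : G.diam ≠ 0 := by
    rw [Ne, SimpleGraph.diam_eq_zero_iff_ediam_eq_top]
    exact SimpleGraph.connected_iff_ediam_ne_top.1 hG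
  refine ⟨t, ht.trans (h.roundEnd_strictMono.monotone ?_), hfinal⟩
  have : 1 ≤ G.diam := Nat.one_le_iff_ne_zero.2 hD
  -- Since `D` is positive, `T + 1 ≤ (c + 1) D`.
  nlinarith
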